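/- **Setting.** A double auction has $n$ buyers and $m$ sellers ($n,m\ge 0$). Buyer $i$'s value $b_i$ and seller $j$'s value $s_j$ are independent; $D^B_i$ and $D^S_j$ are arbitrary finitely supported distributions on $\mathbb R$ with supports $T^B_i,T^S_j$. $\mathcal F$ is a nonempty downward-closed family of matchings, i.e. of sets of pairs $(i,j)$ in which every buyer and every seller occurs at most once. A mechanism assigns to each type profile $(\mathbf b,\mathbf s)\in\prod_iT^B_i\times\prod_jT^S_j$ a lottery over $\mathcal F$, a payment $p^B_i(\mathbf b,\mathbf s)\in\mathbb R$ of each buyer and a gain $p^S_j(\mathbf b,\mathbf s)\in\mathbb R$ of each seller (in expectation over the lottery). Let $x^B_i,x^S_j$ be the probabilities that buyer $i$, seller $j$ trade; utilities are $b_ix^B_i-p^B_i$ and $p^S_j-s_jx^S_j$. The mechanism is *ex-post IR* if truthful utilities are non-negative at every profile, *DSIC* if at every profile no agent gains by reporting another type of her support; *interim IR* and *BIC* are the same conditions for each agent and type in expectation over the other agents' types; *ex-ante WBB* means $\mathbb E[\sum_ip^B_i]\ge\mathbb E[\sum_jp^S_j]$. $\mathrm{GFT}$ is the expected value of $\sum_{(i,j)\text{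 trading}}(b_i-s_j)$, and $\mathrm{OPT}$ is the supremum of $\mathrm{GFT}$ over all interim IR, BIC, ex-ante WBB mechanisms. **Ironed virtual values.** For a buyer with support $\beta_1<\dots<\beta_K$ put $Q_k=\Pr[b\ge\beta_k]$ and $\widetilde R_k=\max\{\delta\beta_{k_1}Q_{k_1}+(1-\delta)\beta_{k_2}Q_{k_2}\;:\;k_1,k_2\in[K],\ \delta\in[0,1],\ Q_k=\delta Q_{k_1}+(1-\delta)Q_{k_2}\}$; then $\tilde\varphi(\beta_K)=\beta_K$ and $\tilde\varphi(\beta_k)=\frac{\widetilde R_k-\widetilde R_{k+1}}{Q_k-Q_{k+1}}$ for $k<K$. For a seller with support $\alpha_1<\dots<\alpha_K$ put $F_k=\Pr[s\le\alpha_k]$ and $\widetilde U_k=\min\{\delta\alpha_{k_1}F_{k_1}+(1-\delta)\alpha_{k_2}F_{k_2}\;:\;k_1,k_2\in[K],\ \delta\in[0,1],\ F_k=\delta F_{k_1}+(1-\delta)F_{k_2}\}$; then $\tilde\tau(\alpha_1)=\alpha_1$ and $\tilde\tau(\alpha_k)=\frac{\widetilde U_k-\widetilde U_{k-1}}{F_k-F_{k-1}}$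 for $k>1$. **Mechanisms.** At each profile GSOM selects a matching in $\mathcal F$ of maximum total weight for the pair weights $\tilde\varphi_i(b_i)-s_j$, and GBOM does so for the weights $b_i-\tilde\tau_j(s_j)$; ties are broken by a fixed strict ranking of the sets of pairs (e.g. lexicographically), arbitrary for each of the two mechanisms. Both use threshold payments: agents who do not trade pay and receive $0$; a trading buyer pays the smallest $b_i'\in T^B_i$, and a trading seller receives the largest $s_j'\in T^S_j$, with which she would still trade, the other reports being fixed. **Theorem.** In every double auction, GSOM and GBOM are both ex-post IR, DSIC and ex-ante WBB. The set of GFT values that defines $\mathrm{OPT}$ is nonempty and bounded above, and $$\mathrm{GFT}_{\mathrm{GSOM}}+\mathrm{GFT}_{\mathrm{GBOM}}\ \ge\ \mathrm{OPT},\qquad \max\{\mathrm{GFT}_{\mathrm{GSOM}},\mathrm{GFT}_{\mathrm{GBOM}}\}\ \ge\ \tfrac12\,\mathrm{OPT}.$$ In particular there is an ex-post IR, DSIC and ex-ante WBB mechanism with $\mathrm{GFT}\ge\tfrac12\,\mathrm{OPT}$. -/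

import Mathlib

open Finset

noncomputable section

/-- A discrete (finitely supported) probability distribution on the real line:
the finite support and the probability of each of its points. -/
structure FinDist where
  supp : Finset ℝ
  mass : ℝ → ℝ
  mass_pos : ∀ t ∈ supp, 0 < mass t
  mass_sum : ∑ t ∈ supp, mass t = 1

namespace FinDist

/-- The type space: the points of the support. -/
abbrev Ty (D : FinDist) : Type := {t : ℝ // t ∈ D.supp}

/-- `Pr[v ≥ t]`, the quantile of the value `t`. -/
def upper (D : FinDist) (t : ℝ) : ℝ := ∑ r ∈ D.supp with t ≤ r, D.mass r

/-- `Pr[v ≤ t]`, the cumulative distribution function. -/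
def cdf (D : FinDist) (t : ℝ) : ℝ := ∑ r ∈ D.supp with r ≤ t, D.mass r

/-- The ironed revenue curve at the quantile of the support point `t`: the largest value, at the
abscissa `upper t`, of a chord joining two points `(upper k, k * upper k)` of the revenue curve
(the concave hull of the revenue curve in quantile space). -/
def ironedRevenue (D : FinDist) (t : ℝ) : ℝ :=
  sSup {v : ℝ | ∃ k₁ ∈ D.supp, ∃ k₂ ∈ D.supp, ∃ δ ∈ Set.Icc (0 : ℝ) 1,
    D.upper t = δ * D.upper k₁ + (1 - δ) * D.upper k₂ ∧
    v = δ * (k₁ * D.upper k₁) + (1 - δ) * (k₂ * D.upper k₂)}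

/-- The ironed cost curve at the quantile of the support point `t`: the smallest value, at the
abscissa `cdf t`, of a chord joining two points `(cdf k, k * cdf k)` of the cost curve
(the convex hull of the curve `q ↦ q * F⁻¹(q)`). -/
def ironedCost (D : FinDist) (t : ℝ) : ℝ :=
  sInf {v : ℝ | ∃ k₁ ∈ D.supp, ∃ k₂ ∈ D.supp, ∃ δ ∈ Set.Icc (0 : ℝ) 1,
    D.cdf t = δ * D.cdf k₁ + (1 - δ) * D.cdf k₂ ∧
    v = δ * (k₁ * D.cdf k₁) + (1 - δ) * (k₂ * D.cdf k₂)}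

/-- Myerson ironed virtual value of a buyer: the slope of the ironed revenue curve between the
quantiles of the next larger support point and of `t`; at the largest support point it is `t`. -/
def buyerVirtual (D : FinDist) (t : ℝ) : ℝ :=
  if h : (D.supp.filter (fun r => t < r)).Nonempty then
    (D.ironedRevenue t - D.ironedRevenue ((D.supp.filter (fun r => t < r)).min' h)) /
      (D.upper t - D.upper ((D.supp.filter (fun r => t < r)).min' h))
  else t

/-- Myerson ironed virtual value of a seller: the slope of the ironed cost curve between the
quantiles of the next smaller support point and of `t`; at the smallest support point it is `t`. -/
def sellerVirtual (D : FinDist) (t : ℝ) : ℝ :=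
  if h : (D.supp.filter (fun r => r < t)).Nonempty then
    (D.ironedCost t - D.ironedCost ((D.supp.filter (fun r => r < t)).max' h)) /
      (D.cdf t - D.cdf ((D.supp.filter (fun r => r < t)).max' h))
  else t

end FinDist

/-- A double auction with `n` buyers and `m` sellers: independent discrete value distributions and
a nonempty downward-closed family of feasible matchings (sets of buyer-seller pairs). -/
structure DoubleAuction (n m : ℕ) where
  buyerDist : Fin n → FinDist
  sellerDist : Fin m → FinDist
  feasible : Finset (Finset (Fin n × Fin m))
  feasible_nonempty : feasible.Nonempty
  feasible_matching_buyer : ∀ M ∈ feasible, ∀ i j j', (i, j) ∈ M → (i, j') ∈ M → j = j'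
  feasible_matching_seller : ∀ M ∈ feasible, ∀ i i' j, (i, j) ∈ M → (i', j) ∈ M → i = i'
  feasible_downward_closed : ∀ M ∈ feasible, ∀ M' ⊆ M, M' ∈ feasible

namespace DoubleAuction

variable {n m : ℕ}

/-- Buyer type profiles. -/
abbrev BProf (𝒜 : DoubleAuction n m) : Type := ∀ i : Fin n, (𝒜.buyerDist i).Ty

/-- Seller type profiles. -/
abbrev SProf (𝒜 : DoubleAuction n m) : Type := ∀ j : Fin m, (𝒜.sellerDist j).Ty

/-- Expectation over the type profile, all types being drawn independently. -/
def expect (𝒜 : DoubleAuction n m) (g : 𝒜.BProf → 𝒜.SProf → ℝ) : ℝ :=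
  ∑ b : 𝒜.BProf, ∑ s : 𝒜.SProf,
    (∏ i, (𝒜.buyerDist i).mass (b i)) * (∏ j, (𝒜.sellerDist j).mass (s j)) * g b s

/-- A direct mechanism: for each type profile a lottery over feasible matchings, the (expected)
payments of the buyers to the mechanism and the (expected) gains of the sellers from it. -/
structure Mechanism (𝒜 : DoubleAuction n m) where
  lottery : 𝒜.BProf → 𝒜.SProf → Finset (Fin n × Fin m) → ℝ
  lottery_nonneg : ∀ b s M, 0 ≤ lottery b s M
  lottery_feasible : ∀ b s, ∀ M ∉ 𝒜.feasible, lottery b s M = 0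
  lottery_sum : ∀ b s, ∑ M ∈ 𝒜.feasible, lottery b s M = 1
  payB : 𝒜.BProf → 𝒜.SProf → Fin n → ℝ
  payS : 𝒜.BProf → 𝒜.SProf → Fin m → ℝ

namespace Mechanism

variable {𝒜 : DoubleAuction n m}

/-- The probability that buyer `i` receives an item. -/
def xB (X : 𝒜.Mechanism) (b : 𝒜.BProf) (s : 𝒜.SProf) (i : Fin n) : ℝ :=
  ∑ M ∈ 𝒜.feasible with ∃ j, (i, j) ∈ M, X.lottery b s M

/-- The probability that seller `j` sells her item. -/
def xS (X : 𝒜.Mechanism) (b : 𝒜.BProf) (s : 𝒜.SProf) (j : Fin m) : ℝ :=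
  ∑ M ∈ 𝒜.feasible with ∃ i, (i, j) ∈ M, X.lottery b s M

/-- Utility of buyer `i` with true value `v` when the reported profile is `(b, s)`. -/
def utilB (X : 𝒜.Mechanism) (i : Fin n) (v : ℝ) (b : 𝒜.BProf) (s : 𝒜.SProf) : ℝ :=
  v * X.xB b s i - X.payB b s i

/-- Utility of seller `j` with true value `v` when the reported profile is `(b, s)`. -/
def utilS (X : 𝒜.Mechanism) (j : Fin m) (v : ℝ) (b : 𝒜.BProf) (s : 𝒜.SProf) : ℝ :=
  X.payS b s j - v * X.xS b s j

/-- Interim utility of buyer `i` with true type `t` who reports `t'`. The `i`-th coordinate of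
`b` is overwritten, so this is the average over the other buyers and the sellers. -/
def interimB (X : 𝒜.Mechanism) (i : Fin n) (t t' : (𝒜.buyerDist i).Ty) : ℝ :=
  𝒜.expect fun b s => X.utilB i t (Function.update b i t') s

/-- Interim utility of seller `j` with true type `t` who reports `t'`. -/
def interimS (X : 𝒜.Mechanism) (j : Fin m) (t t' : (𝒜.sellerDist j).Ty) : ℝ :=
  𝒜.expect fun b s => X.utilS j t b (Function.update s j t')

/-- Interim individual rationality. -/
def InterimIR (X : 𝒜.Mechanism) : Prop :=
  (∀ i t, 0 ≤ X.interimB i t t) ∧ (∀ j t, 0 ≤ X.interimS j t t)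

/-- Bayesian incentive compatibility. -/
def BIC (X : 𝒜.Mechanism) : Prop :=
  (∀ i t t', X.interimB i t t' ≤ X.interimB i t t) ∧
  (∀ j t t', X.interimS j t t' ≤ X.interimS j t t)

/-- Individual rationality at every type profile. -/
def ExPostIR (X : 𝒜.Mechanism) : Prop :=
  ∀ b s, (∀ i, 0 ≤ X.utilB i (b i) b s) ∧ (∀ j, 0 ≤ X.utilS j (s j) b s)

/-- Dominant strategy incentive compatibility. -/
def DSIC (X : 𝒜.Mechanism) : Prop :=
  ∀ b s, (∀ i t', X.utilB i (b i) (Function.update b i t') s ≤ X.utilB i (b i) b s) ∧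
    (∀ j t', X.utilS j (s j) b (Function.update s j t') ≤ X.utilS j (s j) b s)

/-- Ex-ante weak budget balance. -/
def ExAnteWBB (X : 𝒜.Mechanism) : Prop :=
  𝒜.expect (fun b s => ∑ j, X.payS b s j) ≤ 𝒜.expect (fun b s => ∑ i, X.payB b s i)

/-- Expected gains from trade. -/
def GFT (X : 𝒜.Mechanism) : ℝ :=
  𝒜.expect fun b s => ∑ M ∈ 𝒜.feasible,
    X.lottery b s M * ∑ e ∈ M, ((b e.1 : ℝ) - (s e.2 : ℝ))

end Mechanism

/-- The gains from trade achieved by the (interim) IR, BIC, ex-ante WBB mechanisms. -/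
def achievableGFT (𝒜 : DoubleAuction n m) : Set ℝ :=
  {g | ∃ X : 𝒜.Mechanism, X.InterimIR ∧ X.BIC ∧ X.ExAnteWBB ∧ X.GFT = g}

/-- The optimal gains from trade among (interim) IR, BIC, ex-ante WBB mechanisms. -/
def OPT (𝒜 : DoubleAuction n m) : ℝ := sSup 𝒜.achievableGFT

theorem exists_maxWeightMatching (𝒜 : DoubleAuction n m) (rank : Finset (Fin n × Fin m) ↪ ℕ)
    (w : Fin n × Fin m → ℝ) :
    ∃ M ∈ 𝒜.feasible, (∀ M' ∈ 𝒜.feasible, ∑ e ∈ M', w e ≤ ∑ e ∈ M, w e) ∧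
      ∀ M' ∈ 𝒜.feasible, ∑ e ∈ M', w e = ∑ e ∈ M, w e → rank M ≤ rank M' := by
  obtain ⟨M₀, h₀, hmax⟩ :=
    𝒜.feasible.exists_max_image (fun M => ∑ e ∈ M, w e) 𝒜.feasible_nonempty
  obtain ⟨M, hM, hmin⟩ :=
    (𝒜.feasible.filter (fun M => ∑ e ∈ M, w e = ∑ e ∈ M₀, w e)).exists_min_image rank
      ⟨M₀, by simp [h₀]⟩
  rw [Finset.mem_filter] at hM
  refine ⟨M, hM.1, fun M' hM' => (hmax M' hM').trans hM.2.ge, fun M' hM' h => ?_⟩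
  exact hmin M' (Finset.mem_filter.2 ⟨hM', h.trans hM.2⟩)

/-- The maximum weight feasible matching for the edge weights `w`; among several, the one that
comes first in the fixed strict ranking `rank` of all sets of pairs (e.g. a lexicographic one). -/
def maxWeightMatching (𝒜 : DoubleAuction n m) (rank : Finset (Fin n × Fin m) ↪ ℕ)
    (w : Fin n × Fin m → ℝ) : Finset (Fin n × Fin m) :=
  (𝒜.exists_maxWeightMatching rank w).choose

/-- The threshold payment of buyer `i` under the deterministic allocation rule `A`: `0` if she
does not trade, otherwise the smallest report with which she trades. -/
def thresholdB (𝒜 : DoubleAuction n m) (A : 𝒜.BProf → 𝒜.SProf → Finset (Fin n × Fin m))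
    (b : 𝒜.BProf) (s : 𝒜.SProf) (i : Fin n) : ℝ :=
  if h : ∃ j, (i, j) ∈ A b s then
    ((univ.filter fun t : (𝒜.buyerDist i).Ty =>
      ∃ j, (i, j) ∈ A (Function.update b i t) s).min' ⟨b i, by simpa using h⟩ : ℝ)
  else 0

/-- The threshold payment to seller `j` under the deterministic allocation rule `A`: `0` if she
does not trade, otherwise the largest report with which she trades. -/
def thresholdS (𝒜 : DoubleAuction n m) (A : 𝒜.BProf → 𝒜.SProf → Finset (Fin n × Fin m))
    (b : 𝒜.BProf) (s : 𝒜.SProf) (j : Fin m) : ℝ :=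
  if h : ∃ i, (i, j) ∈ A b s then
    ((univ.filter fun t : (𝒜.sellerDist j).Ty =>
      ∃ i, (i, j) ∈ A b (Function.update s j t)).max' ⟨s j, by simpa using h⟩ : ℝ)
  else 0

/-- The deterministic mechanism that selects the maximum weight feasible matching for the
edge weights `w b s` and charges threshold payments. -/
def matchingMechanism (𝒜 : DoubleAuction n m) (rank : Finset (Fin n × Fin m) ↪ ℕ)
    (w : 𝒜.BProf → 𝒜.SProf → Fin n × Fin m → ℝ) : 𝒜.Mechanism where
  lottery b s M := if M = 𝒜.maxWeightMatching rank (w b s) then 1 else 0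
  lottery_nonneg b s M := by split_ifs <;> norm_num
  lottery_feasible b s M hM := by
    rw [if_neg]
    rintro rfl
    exact hM (𝒜.exists_maxWeightMatching rank (w b s)).choose_spec.1
  lottery_sum b s := by
    rw [Finset.sum_ite_eq', if_pos]
    exact (𝒜.exists_maxWeightMatching rank (w b s)).choose_spec.1
  payB := 𝒜.thresholdB fun b s => 𝒜.maxWeightMatching rank (w b s)
  payS := 𝒜.thresholdS fun b s => 𝒜.maxWeightMatching rank (w b s)

/-- The Generalized Seller-Offering Mechanism. -/
def GSOM (𝒜 : DoubleAuction n m) (rank : Finset (Fin n × Fin m) ↪ ℕ) : 𝒜.Mechanism :=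
  𝒜.matchingMechanism rank fun b s e =>
    (𝒜.buyerDist e.1).buyerVirtual (b e.1) - (s e.2 : ℝ)

/-- The Generalized Buyer-Offering Mechanism. -/
def GBOM (𝒜 : DoubleAuction n m) (rank : Finset (Fin n × Fin m) ↪ ℕ) : 𝒜.Mechanism :=
  𝒜.matchingMechanism rank fun b s e =>
    (b e.1 : ℝ) - (𝒜.sellerDist e.2).sellerVirtual (s e.2)

end DoubleAuction

end

/-!
Write `φ` for the ironed virtual value of a buyer and `τ` for that of a seller (a virtual cost).
The bound on the optimum rests on two estimates for an interim IR, BIC, ex-ante WBB mechanism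
with trading probabilities `x`. Incentive constraints and summation by parts along the support
bound a buyer's expected payment by `E[φ x]` and a seller's expected gain from below by `E[τ x]`
(`FinDist.payment_le_virtual`, `FinDist.virtual_le_gain`), so weak budget balance gives
`E[∑ τ x] ≤ E[∑ φ x]`. Hence the gains from trade `E[∑ b x - ∑ s x]` are at most
`E[∑ φ x - ∑ s x] + E[∑ b x - ∑ τ x]`. The first summand is an average of matching weights for
the pair weights `φ - s`, so it is at most the expected maximum weight, and this is at most the
gains from trade of GSOM because `φ b ≤ b`. Likewise the second summand is at most the gains from
trade of GBOM because `s ≤ τ s` (`DoubleAuction.lottery_weight_le_GFT`).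

Incentives come from one exchange argument, `DoubleAuction.maxWeightMatching_eq_of_boost`: if all
matchings in which an agent trades gain the same weight and such a matching was selected, then the
same matching stays selected, ties included. As virtual values are monotone, each agent faces a
posted price, and DSIC and ex-post IR follow (`DoubleAuction.exists_postedPriceB`,
`DoubleAuction.exists_postedPriceS`).

For budget balance of GSOM, a trading seller's threshold is at most the virtual value of her
partner, because the matching is unchanged when she reports the threshold and no selected pair has
negative weight (`DoubleAuction.sum_payS_le`). A buyer's posted price lies at a jump of `φ`, where
the ironed revenue curve touches the revenue curve (`FinDist.ironedRevenue_eq_of_jump`), so her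
expected payment equals `E[φ x]`. GBOM is symmetric.

The ironed revenue curve is handled through its supporting lines
(`FinDist.exists_supporting_line`), which encode its concavity, and the seller's curve is reduced
to the buyer's by negating values (`FinDist.neg`).
-/

noncomputable section

namespace FinDist

/-! ### Consecutive support points -/

/-- `t'` is the support point of `D` that directly follows the support point `t`. -/
structure IsNext (D : FinDist) (t t' : ℝ) : Prop where
  mem : t ∈ D.supp
  mem' : t' ∈ D.supp
  lt : t < t'
  gap : ∀ r ∈ D.supp, r ≤ t ∨ t' ≤ r

theorem exists_isNext (D : FinDist) {t : ℝ} (ht : t ∈ D.supp) {r : ℝ} (hr : r ∈ D.supp)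
    (h : t < r) : ∃ t', D.IsNext t t' := by
  have hne : (D.supp.filter (fun r => t < r)).Nonempty := ⟨r, by simp [hr, h]⟩
  have hm := min'_mem _ hne
  rw [mem_filter] at hm
  refine ⟨_, ht, hm.1, hm.2, fun q hq => ?_⟩
  rcases le_or_gt q t with h1 | h1
  · exact .inl h1
  · exact .inr (min'_le _ _ (by simp [hq, h1]))

theorem exists_isNext_left (D : FinDist) {t : ℝ} (ht : t ∈ D.supp) {r : ℝ} (hr : r ∈ D.supp)
    (h : r < t) : ∃ t', D.IsNext t' t := by
  have hne : (D.supp.filter (fun r => r < t)).Nonempty := ⟨r, by simp [hr, h]⟩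
  have hm := max'_mem _ hne
  rw [mem_filter] at hm
  refine ⟨_, hm.1, ht, hm.2, fun q hq => ?_⟩
  rcases lt_or_ge q t with h1 | h1
  · exact .inl (le_max' _ _ (by simp [hq, h1]))
  · exact .inr h1

/-- Induction along the support from its largest point downwards. -/
theorem next_induction (D : FinDist) {P : ℝ → Prop}
    (top : ∀ t ∈ D.supp, (∀ r ∈ D.supp, r ≤ t) → P t)
    (step : ∀ t t', D.IsNext t t' → P t' → P t) : ∀ t ∈ D.supp, P t := by
  intro t
  induction hc : #(D.supp.filter (fun r => t < r)) using Nat.strong_induction_on generalizing t with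
  | _ c ih =>
    intro ht
    by_cases h : ∀ r ∈ D.supp, r ≤ t
    · exact top t ht h
    · push Not at h
      obtain ⟨r, hr, hlt⟩ := h
      obtain ⟨t', hn⟩ := D.exists_isNext ht hr hlt
      refine step t t' hn (ih _ ?_ t' rfl hn.mem')
      rw [← hc]
      refine card_lt_card (ssubset_iff_of_subset ?_ |>.2 ⟨t', ?_, ?_⟩)
      · intro q hq
        simp only [mem_filter] at hq ⊢
        exact ⟨hq.1, hn.lt.trans hq.2⟩
      · simp [hn.mem', hn.lt]
      · simp

theorem supp_nonempty (D : FinDist) : D.supp.Nonempty := by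
  rw [nonempty_iff_ne_empty]
  intro h
  have := D.mass_sum
  simp [h] at this

theorem filter_le_of_isTop (D : FinDist) {t : ℝ} (ht : t ∈ D.supp) (h : ∀ r ∈ D.supp, r ≤ t) :
    D.supp.filter (fun r => t ≤ r) = {t} := by
  ext r
  simp only [mem_filter, mem_singleton]
  exact ⟨fun hr => le_antisymm (h r hr.1) hr.2, by rintro rfl; exact ⟨ht, le_rfl⟩⟩

theorem IsNext.filter_le {D : FinDist} {t t' : ℝ} (h : D.IsNext t t') :
    D.supp.filter (fun r => t ≤ r) = insert t (D.supp.filter (fun r => t' ≤ r)) := by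
  ext r
  simp only [mem_filter, mem_insert]
  constructor
  · rintro ⟨hr, hle⟩
    rcases h.gap r hr with h1 | h1
    · exact .inl (le_antisymm h1 hle)
    · exact .inr ⟨hr, h1⟩
  · rintro (rfl | ⟨hr, hle⟩)
    · exact ⟨h.mem, le_rfl⟩
    · exact ⟨hr, h.lt.le.trans hle⟩

theorem IsNext.sum_filter_le {D : FinDist} {t t' : ℝ} (h : D.IsNext t t') (f : ℝ → ℝ) :
    ∑ r ∈ D.supp with t ≤ r, f r = f t + ∑ r ∈ D.supp with t' ≤ r, f r := by
  rw [h.filter_le, sum_insert]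
  simp [h.lt]

theorem IsNext.upper_eq {D : FinDist} {t t' : ℝ} (h : D.IsNext t t') :
    D.upper t = D.mass t + D.upper t' := h.sum_filter_le _

theorem upper_anti (D : FinDist) {r t : ℝ} (h : r ≤ t) : D.upper t ≤ D.upper r := by
  refine sum_le_sum_of_subset_of_nonneg (fun q hq => ?_)
    fun q hq _ => (D.mass_pos q (mem_filter.1 hq).1).le
  rw [mem_filter] at hq ⊢
  exact ⟨hq.1, h.trans hq.2⟩

theorem upper_strictAnti (D : FinDist) {r t : ℝ} (hr : r ∈ D.supp) (h : r < t) :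
    D.upper t < D.upper r := by
  refine sum_lt_sum_of_subset (i := r) (fun q hq => ?_) ?_ ?_ (D.mass_pos r hr)
    fun q hq _ => (D.mass_pos q (mem_filter.1 hq).1).le
  · rw [mem_filter] at hq ⊢
    exact ⟨hq.1, h.le.trans hq.2⟩
  · simp [hr]
  · simp [h]

theorem upper_nonneg (D : FinDist) (t : ℝ) : 0 ≤ D.upper t :=
  sum_nonneg fun q hq => (D.mass_pos q (mem_filter.1 hq).1).le

theorem upper_of_isBot (D : FinDist) {t : ℝ} (h : ∀ r ∈ D.supp, t ≤ r) : D.upper t = 1 := by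
  rw [upper, filter_true_of_mem h, D.mass_sum]

theorem upper_of_isTop (D : FinDist) {t : ℝ} (ht : t ∈ D.supp) (h : ∀ r ∈ D.supp, r ≤ t) :
    D.upper t = D.mass t := by
  rw [upper, D.filter_le_of_isTop ht h, sum_singleton]

/-! ### The ironed revenue curve -/

/-- A line that lies above all points of the revenue curve lies above the ironed curve. -/
theorem ironedRevenue_le_of_line (D : FinDist) {t : ℝ} (ht : t ∈ D.supp) {c σ : ℝ}
    (h : ∀ r ∈ D.supp, r * D.upper r ≤ c + σ * D.upper r) :
    D.ironedRevenue t ≤ c + σ * D.upper t := by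
  refine csSup_le ⟨_, t, ht, t, ht, 1, by simp, by ring, rfl⟩ ?_
  rintro v ⟨k₁, hk₁, k₂, hk₂, δ, ⟨h0, h1⟩, hq, rfl⟩
  rw [hq]
  nlinarith [mul_le_mul_of_nonneg_left (h k₁ hk₁) h0,
    mul_le_mul_of_nonneg_left (h k₂ hk₂) (sub_nonneg.2 h1)]

theorem chord_le_ironedRevenue (D : FinDist) {t k₁ k₂ δ : ℝ} (hk₁ : k₁ ∈ D.supp)
    (hk₂ : k₂ ∈ D.supp) (h0 : 0 ≤ δ) (h1 : δ ≤ 1)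
    (h : D.upper t = δ * D.upper k₁ + (1 - δ) * D.upper k₂) :
    δ * (k₁ * D.upper k₁) + (1 - δ) * (k₂ * D.upper k₂) ≤ D.ironedRevenue t := by
  refine le_csSup ?_ ⟨k₁, hk₁, k₂, hk₂, δ, ⟨h0, h1⟩, h, rfl⟩
  obtain ⟨C, hC⟩ := (D.supp.image fun r => r * D.upper r).bddAbove
  refine ⟨C, ?_⟩
  rintro v ⟨l₁, hl₁, l₂, hl₂, ε, ⟨e0, e1⟩, -, rfl⟩
  have a₁ : l₁ * D.upper l₁ ≤ C := hC (by simpa using ⟨l₁, hl₁, rfl⟩)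
  have a₂ : l₂ * D.upper l₂ ≤ C := hC (by simpa using ⟨l₂, hl₂, rfl⟩)
  nlinarith [mul_le_mul_of_nonneg_left a₁ e0, mul_le_mul_of_nonneg_left a₂ (sub_nonneg.2 e1)]

theorem revenue_le_ironedRevenue (D : FinDist) {t : ℝ} (ht : t ∈ D.supp) :
    t * D.upper t ≤ D.ironedRevenue t := by
  have := D.chord_le_ironedRevenue (t := t) ht ht zero_le_one le_rfl (by ring)
  linarith

/-- Concavity of the ironed revenue curve: it has a supporting line at every support point `t`.
The slope separates the slopes of the segments from the points of the revenue curve on one side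
to the ironed curve at `t` from those on the other side, because each chord between the two
sides passes below the ironed curve at `t`. -/
theorem exists_supporting_line (D : FinDist) {t : ℝ} (ht : t ∈ D.supp) :
    ∃ σ : ℝ, ∀ r ∈ D.supp, D.ironedRevenue r ≤ D.ironedRevenue t + σ * (D.upper r - D.upper t) := by
  set H := D.ironedRevenue t
  -- slope of the segment from the revenue point at `r` to the ironed curve at `t`
  set sl : ℝ → ℝ := fun r => (r * D.upper r - H) / (D.upper r - D.upper t) with hsl
  have hcross : ∀ a ∈ D.supp, t < a → ∀ b ∈ D.supp, b < t → sl b ≤ sl a := by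
    intro a ha hta b hb hbt
    have h1 : 0 < D.upper t - D.upper a := sub_pos.2 (D.upper_strictAnti ht hta)
    have h2 : 0 < D.upper b - D.upper t := sub_pos.2 (D.upper_strictAnti hb hbt)
    have h3 : D.upper b - D.upper a ≠ 0 := by linarith
    have hc := D.chord_le_ironedRevenue (t := t) (δ := (D.upper t - D.upper a) /
      (D.upper b - D.upper a)) hb ha (by apply div_nonneg <;> linarith)
      (by rw [div_le_one] <;> linarith) (by field_simp; ring)
    have e : (D.upper t - D.upper a) / (D.upper b - D.upper a) * (b * D.upper b) +
        (1 - (D.upper t - D.upper a) / (D.upper b - D.upper a)) * (a * D.upper a) =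
        ((D.upper t - D.upper a) * (b * D.upper b) + (D.upper b - D.upper t) * (a * D.upper a)) /
          (D.upper b - D.upper a) := by field_simp; ring
    rw [e, div_le_iff₀ (by linarith)] at hc
    have e2 : sl a = (H - a * D.upper a) / (D.upper t - D.upper a) := by
      rw [hsl, ← neg_div_neg_eq, neg_sub, neg_sub]
    rw [e2, hsl, div_le_div_iff₀ h2 h1]
    linarith
  obtain ⟨σ, hσ₁, hσ₂⟩ : ∃ σ, (∀ a ∈ D.supp, t < a → σ ≤ sl a) ∧
      ∀ b ∈ D.supp, b < t → sl b ≤ σ := by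
    by_cases hne : (D.supp.filter (· < t)).Nonempty
    · obtain ⟨b, hb, hmax⟩ := exists_max_image _ sl hne
      rw [mem_filter] at hb
      exact ⟨sl b, fun a ha hta => hcross a ha hta b hb.1 hb.2,
        fun c hc hct => hmax c (by simp [hc, hct])⟩
    · rw [not_nonempty_iff_eq_empty, filter_eq_empty_iff] at hne
      by_cases hne' : (D.supp.filter (t < ·)).Nonempty
      · obtain ⟨a, ha, hmin⟩ := exists_min_image _ sl hne'
        exact ⟨sl a, fun c hc hct => hmin c (by simp [hc, hct]), fun b hb hbt =>
          (hne hb hbt).elim⟩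
      · rw [not_nonempty_iff_eq_empty, filter_eq_empty_iff] at hne'
        exact ⟨0, fun a ha hta => (hne' ha hta).elim, fun b hb hbt => (hne hb hbt).elim⟩
  refine ⟨σ, fun r hr => ?_⟩
  have key := D.ironedRevenue_le_of_line hr (c := H - σ * D.upper t) (σ := σ) fun q hq => ?_
  · linarith
  rcases lt_trichotomy q t with h | rfl | h
  · have := hσ₂ q hq h
    rw [hsl, div_le_iff₀ (sub_pos.2 (D.upper_strictAnti hq h))] at this
    linarith
  · linarith [D.revenue_le_ironedRevenue ht]
  · have := hσ₁ q hq h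
    rw [hsl, le_div_iff_of_neg (sub_neg.2 (D.upper_strictAnti ht h))] at this
    linarith

/-- At an extreme quantile the ironed curve coincides with the revenue curve. -/
theorem ironedRevenue_of_extreme (D : FinDist) {t : ℝ} (ht : t ∈ D.supp)
    (h : (∀ r ∈ D.supp, r ≤ t) ∨ ∀ r ∈ D.supp, t ≤ r) :
    D.ironedRevenue t = t * D.upper t := by
  refine le_antisymm ?_ (D.revenue_le_ironedRevenue ht)
  -- a line through the extreme point that is steep enough lies above all points
  have hne : ∀ r ∈ D.supp, r ≠ t → D.upper r - D.upper t ≠ 0 := fun r hr hrt => by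
    rcases lt_or_gt_of_ne hrt with h | h
    · exact (sub_pos.2 (D.upper_strictAnti hr h)).ne'
    · exact (sub_neg.2 (D.upper_strictAnti ht h)).ne
  -- slope of the segment from the point at `r` to the extreme point
  set sl : ℝ → ℝ := fun r => (r * D.upper r - t * D.upper t) / (D.upper r - D.upper t) with hsl
  have hslmul : ∀ r ∈ D.supp, r * D.upper r = t * D.upper t + sl r * (D.upper r - D.upper t) := by
    intro r hr
    by_cases hrt : r = t
    · simp [hrt]
    · rw [hsl, div_mul_cancel₀ _ (hne r hr hrt)]; ring
  suffices ∃ σ, ∀ r ∈ D.supp, r * D.upper r ≤ t * D.upper t + σ * (D.upper r - D.upper t) by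
    obtain ⟨σ, hσ⟩ := this
    have := D.ironedRevenue_le_of_line ht (c := t * D.upper t - σ * D.upper t) (σ := σ)
      fun r hr => by linarith [hσ r hr]
    linarith
  rcases h with h | h
  · obtain ⟨a, -, ha⟩ := exists_max_image _ sl D.supp_nonempty
    refine ⟨sl a, fun r hr => ?_⟩
    rw [hslmul r hr]
    nlinarith [ha r hr, D.upper_anti (h r hr)]
  · obtain ⟨a, -, ha⟩ := exists_min_image _ sl D.supp_nonempty
    refine ⟨sl a, fun r hr => ?_⟩
    rw [hslmul r hr]
    nlinarith [ha r hr, D.upper_anti (h r hr)]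

/-! ### The ironed virtual value of a buyer -/

theorem buyerVirtual_of_isTop (D : FinDist) {t : ℝ} (h : ∀ r ∈ D.supp, r ≤ t) :
    D.buyerVirtual t = t := by
  rw [buyerVirtual, dif_neg]
  rintro ⟨r, hr⟩
  rw [mem_filter] at hr
  exact (h r hr.1).not_gt hr.2

theorem IsNext.mass_mul_buyerVirtual {D : FinDist} {t t' : ℝ} (h : D.IsNext t t') :
    D.mass t * D.buyerVirtual t = D.ironedRevenue t - D.ironedRevenue t' := by
  have hne : (D.supp.filter (fun r => t < r)).Nonempty := ⟨t', by simp [h.mem', h.lt]⟩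
  have hmin : (D.supp.filter (fun r => t < r)).min' hne = t' := by
    refine le_antisymm (min'_le _ _ (by simp [h.mem', h.lt])) (le_min' _ _ _ fun r hr => ?_)
    rw [mem_filter] at hr
    exact (h.gap r hr.1).resolve_left hr.2.not_ge
  have hm := (D.mass_pos t h.mem).ne'
  rw [buyerVirtual, dif_pos hne, hmin, h.upper_eq, add_sub_cancel_right]
  field_simp

/-- The ironed virtual values of the types above `θ` accumulate to the ironed revenue. -/
theorem sum_mass_mul_buyerVirtual (D : FinDist) : ∀ θ ∈ D.supp,
    ∑ t ∈ D.supp with θ ≤ t, D.mass t * D.buyerVirtual t = D.ironedRevenue θ := by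
  refine D.next_induction (fun t ht htop => ?_) fun t t' h ih => ?_
  · rw [D.filter_le_of_isTop ht htop, sum_singleton, D.buyerVirtual_of_isTop htop,
      D.ironedRevenue_of_extreme ht (.inl htop), D.upper_of_isTop ht htop, mul_comm]
  · rw [h.sum_filter_le, ih, h.mass_mul_buyerVirtual]
    ring

theorem IsNext.buyerVirtual_le_iff {D : FinDist} {t t' : ℝ} (h : D.IsNext t t') (c : ℝ) :
    D.buyerVirtual t ≤ c ↔
      D.ironedRevenue t ≤ D.ironedRevenue t' + c * (D.upper t - D.upper t') := by
  rw [h.upper_eq, ← mul_le_mul_iff_of_pos_left (D.mass_pos t h.mem), h.mass_mul_buyerVirtual]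
  constructor <;> intro h <;> linarith

theorem IsNext.le_buyerVirtual_iff {D : FinDist} {t t' : ℝ} (h : D.IsNext t t') (c : ℝ) :
    c ≤ D.buyerVirtual t ↔
      D.ironedRevenue t' + c * (D.upper t - D.upper t') ≤ D.ironedRevenue t := by
  rw [h.upper_eq, ← mul_le_mul_iff_of_pos_left (D.mass_pos t h.mem), h.mass_mul_buyerVirtual]
  constructor <;> intro h <;> linarith

/-- Ironed virtual values do not exceed values, whatever the sign of the values. -/
theorem buyerVirtual_le (D : FinDist) {t : ℝ} (ht : t ∈ D.supp) : D.buyerVirtual t ≤ t := by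
  by_cases htop : ∀ r ∈ D.supp, r ≤ t
  · exact (D.buyerVirtual_of_isTop htop).le
  push Not at htop
  obtain ⟨r, hr, hlt⟩ := htop
  obtain ⟨t', h⟩ := D.exists_isNext ht hr hlt
  rw [h.buyerVirtual_le_iff]
  obtain ⟨σ, hσ⟩ := D.exists_supporting_line h.mem'
  have ht' := D.revenue_le_ironedRevenue h.mem'
  have hQ := D.upper_nonneg t'
  rcases le_total σ t with hs | hs
  · nlinarith [hσ t ht, D.upper_anti h.lt.le]
  -- the line of slope `t` through the ironed curve at `t'` lies above the revenue curve
  have := D.ironedRevenue_le_of_line ht (c := D.ironedRevenue t' - t * D.upper t') (σ := t)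
    fun q hq => ?_
  · linarith
  rcases h.gap q hq with hq' | hq'
  · nlinarith [D.upper_nonneg q, h.lt]
  · nlinarith [hσ q hq, D.revenue_le_ironedRevenue hq, D.upper_anti hq']

theorem IsNext.buyerVirtual_mono {D : FinDist} {t t' : ℝ} (h : D.IsNext t t') :
    D.buyerVirtual t ≤ D.buyerVirtual t' := by
  by_cases htop : ∀ r ∈ D.supp, r ≤ t'
  · rw [D.buyerVirtual_of_isTop htop]
    exact (D.buyerVirtual_le h.mem).trans h.lt.le
  push Not at htop
  obtain ⟨r, hr, hlt⟩ := htop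
  obtain ⟨t'', h'⟩ := D.exists_isNext h.mem' hr hlt
  obtain ⟨σ, hσ⟩ := D.exists_supporting_line h.mem'
  refine ((h.buyerVirtual_le_iff σ).2 (hσ t h.mem)).trans ((h'.le_buyerVirtual_iff σ).2 ?_)
  linarith [hσ t'' h'.mem']

theorem buyerVirtual_mono (D : FinDist) {t r : ℝ} (ht : t ∈ D.supp) (hr : r ∈ D.supp)
    (h : t ≤ r) : D.buyerVirtual t ≤ D.buyerVirtual r := by
  revert h
  refine D.next_induction (P := fun t => t ≤ r → D.buyerVirtual t ≤ D.buyerVirtual r)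
    (fun t ht htop h => ?_) (fun t t' hn ih h => ?_) t ht
  · rw [le_antisymm h (htop r hr)]
  · rcases hn.gap r hr with h' | h'
    · rw [le_antisymm h h']
    · exact hn.buyerVirtual_mono.trans (ih h')

/-- Where the ironed virtual value jumps, the ironed curve touches the revenue curve: otherwise
a line slightly below the kink of the ironed curve would still be above all points. -/
theorem ironedRevenue_eq_of_jump (D : FinDist) {θ : ℝ} (hθ : θ ∈ D.supp)
    (hjump : ∀ r ∈ D.supp, r < θ → D.buyerVirtual r < D.buyerVirtual θ) :
    D.ironedRevenue θ = θ * D.upper θ := by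
  by_cases htop : ∀ r ∈ D.supp, r ≤ θ
  · exact D.ironedRevenue_of_extreme hθ (.inl htop)
  by_cases hbot : ∀ r ∈ D.supp, θ ≤ r
  · exact D.ironedRevenue_of_extreme hθ (.inr hbot)
  push Not at htop hbot
  obtain ⟨r₁, hr₁, hlt₁⟩ := htop
  obtain ⟨r₀, hr₀, hlt₀⟩ := hbot
  obtain ⟨θ₁, h₁⟩ := D.exists_isNext hθ hr₁ hlt₁
  obtain ⟨θ₀, h₀⟩ := D.exists_isNext_left hθ hr₀ hlt₀
  refine le_antisymm ?_ (D.revenue_le_ironedRevenue hθ)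
  by_contra! hgap
  obtain ⟨σ, hσ₀, hσ₁⟩ := exists_between (hjump θ₀ h₀.mem h₀.lt)
  have hd₀ : 0 < D.upper θ₀ - D.upper θ := sub_pos.2 (D.upper_strictAnti h₀.mem h₀.lt)
  have hd₁ : 0 < D.upper θ - D.upper θ₁ := sub_pos.2 (D.upper_strictAnti hθ h₁.lt)
  obtain ⟨ε, hε, hεlt⟩ := exists_between (lt_min (sub_pos.2 hgap)
    (lt_min (mul_pos (sub_pos.2 hσ₀) hd₀) (mul_pos (sub_pos.2 hσ₁) hd₁)))
  rw [lt_min_iff, lt_min_iff] at hεlt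
  obtain ⟨he, he₀, he₁⟩ := hεlt
  have := D.ironedRevenue_le_of_line hθ (c := D.ironedRevenue θ - ε - σ * D.upper θ) (σ := σ)
    fun q hq => ?_
  · linarith
  rcases h₀.gap q hq with hq' | hq'
  · -- left of `θ` the curve stays below the line of slope `buyerVirtual θ₀`
    obtain ⟨μ, hμ⟩ := D.exists_supporting_line h₀.mem
    have hμ' : μ ≤ D.buyerVirtual θ₀ := by
      rw [h₀.le_buyerVirtual_iff]
      linarith [hμ θ hθ]
    have e := (h₀.buyerVirtual_le_iff (D.buyerVirtual θ₀)).1 le_rfl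
    have e' := (h₀.le_buyerVirtual_iff (D.buyerVirtual θ₀)).1 le_rfl
    have hQ := D.upper_anti hq'
    have a := D.revenue_le_ironedRevenue hq
    have b := hμ q hq
    have c := mul_le_mul_of_nonneg_right hμ' (sub_nonneg.2 hQ)
    have d := mul_le_mul_of_nonneg_right hσ₀.le (sub_nonneg.2 hQ)
    linarith
  rcases h₁.gap q hq with hq'' | hq''
  · rw [le_antisymm hq'' hq']
    linarith
  · obtain ⟨μ, hμ⟩ := D.exists_supporting_line h₁.mem'
    have hμ' : D.buyerVirtual θ ≤ μ := by
      rw [h₁.buyerVirtual_le_iff]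
      linarith [hμ θ hθ]
    have e := (h₁.buyerVirtual_le_iff (D.buyerVirtual θ)).1 le_rfl
    have e' := (h₁.le_buyerVirtual_iff (D.buyerVirtual θ)).1 le_rfl
    have hQ := D.upper_anti hq''
    have a := D.revenue_le_ironedRevenue hq
    have b := hμ q hq
    have c := mul_le_mul_of_nonneg_right hμ' (sub_nonneg.2 hQ)
    have d := mul_le_mul_of_nonneg_right hσ₁.le (sub_nonneg.2 hQ)
    linarith

/-- Expected payment of a buyer with a posted price at a jump of the ironed virtual value. -/
theorem sum_virtual_eq_price (D : FinDist) {θ : ℝ} (hθ : θ ∈ D.supp)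
    (hjump : ∀ r ∈ D.supp, r < θ → D.buyerVirtual r < D.buyerVirtual θ) :
    ∑ t ∈ D.supp with θ ≤ t, D.mass t * D.buyerVirtual t = θ * D.upper θ := by
  rw [D.sum_mass_mul_buyerVirtual θ hθ, D.ironedRevenue_eq_of_jump hθ hjump]

/-- Payments that are incentive compatible and individually rational for the allocation `x`
are bounded by the expected ironed virtual value. -/
theorem payment_le_virtual (D : FinDist) (x p : ℝ → ℝ)
    (hir : ∀ t ∈ D.supp, 0 ≤ t * x t - p t)
    (hic : ∀ t ∈ D.supp, ∀ t' ∈ D.supp, t * x t' - p t' ≤ t * x t - p t) :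
    ∑ t ∈ D.supp, D.mass t * p t ≤ ∑ t ∈ D.supp, D.mass t * (D.buyerVirtual t * x t) := by
  -- summation by parts, carried out from the top of the support
  have key : ∀ θ ∈ D.supp, ∑ t ∈ D.supp with θ ≤ t, D.mass t * p t ≤
      ∑ t ∈ D.supp with θ ≤ t, D.mass t * (D.buyerVirtual t * x t) +
        (D.upper θ * p θ - D.ironedRevenue θ * x θ) := by
    refine D.next_induction (fun t ht htop => ?_) fun t t' h ih => ?_
    · rw [D.filter_le_of_isTop ht htop, sum_singleton, sum_singleton,
        D.buyerVirtual_of_isTop htop, D.ironedRevenue_of_extreme ht (.inl htop),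
        D.upper_of_isTop ht htop]
      linarith
    · rw [h.sum_filter_le, h.sum_filter_le, h.upper_eq]
      have e := h.mass_mul_buyerVirtual
      have e' : D.mass t * (D.buyerVirtual t * x t) =
        (D.ironedRevenue t - D.ironedRevenue t') * x t := by rw [← e]; ring
      rw [e']
      have i₁ := hic t h.mem t' h.mem'
      have i₂ := hic t' h.mem' t h.mem
      have hmono : 0 ≤ x t' - x t := by
        by_contra! hc
        nlinarith [h.lt]
      have hR := mul_le_mul_of_nonneg_right (D.revenue_le_ironedRevenue h.mem') hmono
      have hp : p t' - p t ≤ t' * (x t' - x t) := by linarith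
      have hQ := mul_le_mul_of_nonneg_left hp (D.upper_nonneg t')
      linarith
  have hmem := min'_mem _ D.supp_nonempty
  have hbot : ∀ r ∈ D.supp, D.supp.min' D.supp_nonempty ≤ r := fun r hr => min'_le _ _ hr
  have := key _ hmem
  rw [filter_true_of_mem hbot, D.ironedRevenue_of_extreme hmem (.inr hbot),
    D.upper_of_isBot hbot] at this
  linarith [hir _ hmem]

/-! ### Sellers as buyers with negated values -/

/-- The distribution of `-v` for `v` distributed according to `D`. -/
def neg (D : FinDist) : FinDist where
  supp := D.supp.map (Equiv.neg ℝ).toEmbedding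
  mass t := D.mass (-t)
  mass_pos t ht := D.mass_pos _ (by simpa [neg_eq_iff_eq_neg] using ht)
  mass_sum := by simpa using D.mass_sum

theorem mem_neg_supp (D : FinDist) {t : ℝ} : t ∈ D.neg.supp ↔ -t ∈ D.supp := by
  simp [neg]

theorem sum_neg_supp (D : FinDist) (f : ℝ → ℝ) :
    ∑ t ∈ D.neg.supp, f t = ∑ t ∈ D.supp, f (-t) := by
  simp [neg]

theorem sum_neg_supp_filter (D : FinDist) (f : ℝ → ℝ) (θ : ℝ) :
    ∑ t ∈ D.neg.supp with -θ ≤ t, f t = ∑ t ∈ D.supp with t ≤ θ, f (-t) := by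
  rw [sum_filter, sum_neg_supp, sum_filter]
  simp

theorem upper_neg (D : FinDist) (t : ℝ) : D.neg.upper (-t) = D.cdf t := by
  rw [upper, sum_neg_supp_filter, cdf]
  simp [neg]

theorem ironedRevenue_neg (D : FinDist) (t : ℝ) :
    D.neg.ironedRevenue (-t) = -D.ironedCost t := by
  rw [ironedRevenue, ironedCost, Real.sInf_def, neg_neg]
  congr 1
  ext v
  simp only [Set.mem_ofPred_eq, Set.mem_neg, mem_neg_supp]
  constructor
  · rintro ⟨k₁, hk₁, k₂, hk₂, δ, hδ, hq, rfl⟩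
    refine ⟨-k₁, hk₁, -k₂, hk₂, δ, hδ, ?_, ?_⟩
    · simpa [← upper_neg] using hq
    · simp only [← upper_neg, neg_neg]
      ring
  · rintro ⟨k₁, hk₁, k₂, hk₂, δ, hδ, hq, hv⟩
    refine ⟨-k₁, by simpa, -k₂, by simpa, δ, hδ, ?_, ?_⟩
    · simpa [upper_neg] using hq
    · simp only [upper_neg]
      linarith

theorem buyerVirtual_neg (D : FinDist) {t : ℝ} (ht : t ∈ D.supp) :
    D.neg.buyerVirtual (-t) = -D.sellerVirtual t := by
  by_cases h : (D.supp.filter (fun r => r < t)).Nonempty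
  · have hmem := max'_mem _ h
    set t' := (D.supp.filter (fun r => r < t)).max' h with ht'
    rw [mem_filter] at hmem
    have hn : D.neg.IsNext (-t) (-t') := by
      refine ⟨by simpa [mem_neg_supp], by simpa [mem_neg_supp] using hmem.1, by simpa using hmem.2,
        fun r hr => ?_⟩
      rw [mem_neg_supp] at hr
      rcases le_or_gt r (-t) with h1 | h1
      · exact .inl h1
      · have : -r ≤ t' := le_max' _ _ (by simpa [hr] using neg_lt.1 h1)
        exact .inr (by linarith)
    have e := hn.mass_mul_buyerVirtual
    have e' := hn.upper_eq
    have hpos := D.neg.mass_pos _ hn.mem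
    rw [sellerVirtual, dif_pos h, ← ht', ← upper_neg, ← upper_neg, e', add_sub_cancel_right]
    rw [ironedRevenue_neg, ironedRevenue_neg] at e
    field_simp
    linarith
  · rw [sellerVirtual, dif_neg h, buyerVirtual_of_isTop]
    intro r hr
    rw [mem_neg_supp] at hr
    by_contra! hlt
    exact h ⟨-r, by simp [hr, neg_lt.1 hlt]⟩

theorem le_sellerVirtual (D : FinDist) {t : ℝ} (ht : t ∈ D.supp) : t ≤ D.sellerVirtual t := by
  have := D.neg.buyerVirtual_le (t := -t) (by simpa [mem_neg_supp])
  rw [D.buyerVirtual_neg ht] at this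
  linarith

theorem sellerVirtual_mono (D : FinDist) {t r : ℝ} (ht : t ∈ D.supp) (hr : r ∈ D.supp)
    (h : t ≤ r) : D.sellerVirtual t ≤ D.sellerVirtual r := by
  have := D.neg.buyerVirtual_mono (t := -r) (r := -t) (by simpa [mem_neg_supp])
    (by simpa [mem_neg_supp]) (by linarith)
  rw [D.buyerVirtual_neg ht, D.buyerVirtual_neg hr] at this
  linarith

/-- Expected gain of a seller with a posted price at a jump of the ironed virtual value. -/
theorem sum_sellerVirtual_eq_price (D : FinDist) {θ : ℝ} (hθ : θ ∈ D.supp)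
    (hjump : ∀ r ∈ D.supp, θ < r → D.sellerVirtual θ < D.sellerVirtual r) :
    ∑ t ∈ D.supp with t ≤ θ, D.mass t * D.sellerVirtual t = θ * D.cdf θ := by
  have := D.neg.sum_virtual_eq_price (θ := -θ) (by simpa [mem_neg_supp]) fun r hr hlt => ?_
  · rw [D.sum_neg_supp_filter, upper_neg] at this
    rw [← neg_inj, ← neg_mul, ← this, ← sum_neg_distrib]
    refine sum_congr rfl fun t ht => ?_
    rw [D.buyerVirtual_neg (mem_filter.1 ht).1]
    simp [neg]
  · rw [mem_neg_supp] at hr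
    have := hjump _ hr (by linarith)
    rw [← neg_neg r, D.buyerVirtual_neg hr, D.buyerVirtual_neg hθ]
    linarith

/-- Gains that are incentive compatible and individually rational for the allocation `x` are at
least the expected ironed virtual cost. -/
theorem virtual_le_gain (D : FinDist) (x p : ℝ → ℝ)
    (hir : ∀ t ∈ D.supp, 0 ≤ p t - t * x t)
    (hic : ∀ t ∈ D.supp, ∀ t' ∈ D.supp, p t' - t * x t' ≤ p t - t * x t) :
    ∑ t ∈ D.supp, D.mass t * (D.sellerVirtual t * x t) ≤ ∑ t ∈ D.supp, D.mass t * p t := by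
  have := D.neg.payment_le_virtual (fun t => x (-t)) (fun t => -p (-t))
    (fun t ht => by linarith [hir _ (D.mem_neg_supp.1 ht)])
    (fun t ht t' ht' => by
      linarith [hic _ (D.mem_neg_supp.1 ht) _ (D.mem_neg_supp.1 ht')])
  rw [sum_neg_supp, sum_neg_supp, ← neg_le_neg_iff, ← sum_neg_distrib, ← sum_neg_distrib] at this
  convert this using 1
  · refine sum_congr rfl fun t ht => ?_
    rw [D.buyerVirtual_neg ht]
    simp [neg]
  · refine sum_congr rfl fun t ht => ?_
    simp [neg]

end FinDist

namespace DoubleAuction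

variable {n m : ℕ}

/-! ### Expectations over independent types -/

/-- Redrawing one of several independent types does not change an expectation. -/
theorem sum_prod_resample {ι : Type*} [Fintype ι] [DecidableEq ι] {T : ι → Type*}
    [∀ i, Fintype (T i)] (μ : ∀ i, T i → ℝ) (i : ι) (hμ : ∑ t, μ i t = 1)
    (g : (∀ i, T i) → ℝ) :
    ∑ b, (∏ j, μ j (b j)) * g b =
      ∑ b, (∏ j, μ j (b j)) * ∑ t, μ i t * g (Function.update b i t) := by
  -- exchange the old and the new type
  let swap : (∀ i, T i) × T i → (∀ i, T i) × T i := fun p => (Function.update p.1 i p.2, p.1 i)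
  have hswap : Function.Involutive swap := fun p => by simp [swap]
  have hw : ∀ (b : ∀ i, T i) (t : T i),
      (∏ j, μ j (Function.update b i t j)) * μ i (b i) = (∏ j, μ j (b j)) * μ i t := by
    intro b t
    rw [← mul_prod_erase univ _ (mem_univ i), ← mul_prod_erase univ (fun j => μ j (b j))
      (mem_univ i), Function.update_self]
    have : ∏ j ∈ univ.erase i, μ j (Function.update b i t j) = ∏ j ∈ univ.erase i, μ j (b j) :=
      prod_congr rfl fun j hj => by rw [Function.update_of_ne (ne_of_mem_erase hj)]
    rw [this]
    ring
  calc ∑ b, (∏ j, μ j (b j)) * g b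
      = ∑ p : (∀ i, T i) × T i, (∏ j, μ j (p.1 j)) * μ i p.2 * g p.1 := by
        rw [Fintype.sum_prod_type]
        refine sum_congr rfl fun b _ => ?_
        simp only
        rw [← sum_mul, ← mul_sum, hμ, mul_one]
    _ = ∑ p : (∀ i, T i) × T i,
          (∏ j, μ j (p.1 j)) * μ i p.2 * g (Function.update p.1 i p.2) := by
        rw [← Equiv.sum_comp hswap.toPerm]
        refine sum_congr rfl fun p _ => ?_
        simp only [Function.Involutive.coe_toPerm, swap]
        rw [hw]
    _ = _ := by
        rw [Fintype.sum_prod_type]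
        refine sum_congr rfl fun b _ => ?_
        rw [mul_sum]
        exact sum_congr rfl fun t _ => mul_assoc _ _ _

variable (𝒜 : DoubleAuction n m)

theorem sum_mass_type (D : FinDist) : ∑ t : D.Ty, D.mass t = 1 := by
  rw [sum_coe_sort D.supp D.mass, D.mass_sum]

theorem expect_add (g h : 𝒜.BProf → 𝒜.SProf → ℝ) :
    𝒜.expect (fun b s => g b s + h b s) = 𝒜.expect g + 𝒜.expect h := by
  simp [expect, mul_add, sum_add_distrib]

theorem expect_sub (g h : 𝒜.BProf → 𝒜.SProf → ℝ) :
    𝒜.expect (fun b s => g b s - h b s) = 𝒜.expect g - 𝒜.expect h := by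
  simp [expect, mul_sub, sum_sub_distrib]

theorem expect_mul_left (c : ℝ) (g : 𝒜.BProf → 𝒜.SProf → ℝ) :
    𝒜.expect (fun b s => c * g b s) = c * 𝒜.expect g := by
  simp only [expect, mul_sum, mul_left_comm c]

theorem expect_sum {κ : Type*} (S : Finset κ) (g : κ → 𝒜.BProf → 𝒜.SProf → ℝ) :
    𝒜.expect (fun b s => ∑ k ∈ S, g k b s) = ∑ k ∈ S, 𝒜.expect (g k) := by
  induction S using Finset.cons_induction with
  | empty => simp [expect]
  | cons k S hk ih => simp only [sum_cons, expect_add, ih]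

theorem expect_mono {g h : 𝒜.BProf → 𝒜.SProf → ℝ} (hgh : ∀ b s, g b s ≤ h b s) :
    𝒜.expect g ≤ 𝒜.expect h := by
  refine sum_le_sum fun b _ => sum_le_sum fun s _ => mul_le_mul_of_nonneg_left (hgh b s) ?_
  exact mul_nonneg (prod_nonneg fun i _ => ((𝒜.buyerDist i).mass_pos _ (b i).2).le)
    (prod_nonneg fun j _ => ((𝒜.sellerDist j).mass_pos _ (s j).2).le)

theorem expect_nonneg {g : 𝒜.BProf → 𝒜.SProf → ℝ} (hg : ∀ b s, 0 ≤ g b s) :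
    0 ≤ 𝒜.expect g := by
  simpa [expect] using 𝒜.expect_mono (g := fun _ _ => 0) hg

theorem expect_resampleB (i : Fin n) (g : 𝒜.BProf → 𝒜.SProf → ℝ) :
    𝒜.expect g = 𝒜.expect fun b s =>
      ∑ t : (𝒜.buyerDist i).Ty, (𝒜.buyerDist i).mass t * g (Function.update b i t) s := by
  unfold expect
  rw [sum_comm, sum_comm (s := (univ : Finset 𝒜.BProf))]
  refine sum_congr rfl fun s _ => ?_
  have := sum_prod_resample (fun i (t : (𝒜.buyerDist i).Ty) => (𝒜.buyerDist i).mass t) i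
    (sum_mass_type _) fun b => (∏ j, (𝒜.sellerDist j).mass (s j)) * g b s
  simp only [mul_assoc, this, mul_sum]
  refine sum_congr rfl fun b _ => sum_congr rfl fun t _ => by ring

theorem expect_resampleS (j : Fin m) (g : 𝒜.BProf → 𝒜.SProf → ℝ) :
    𝒜.expect g = 𝒜.expect fun b s =>
      ∑ t : (𝒜.sellerDist j).Ty, (𝒜.sellerDist j).mass t * g b (Function.update s j t) := by
  unfold expect
  refine sum_congr rfl fun b _ => ?_
  simp only [mul_assoc, ← mul_sum]
  rw [sum_prod_resample (fun j (t : (𝒜.sellerDist j).Ty) => (𝒜.sellerDist j).mass t) j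
    (sum_mass_type _) fun s => g b s]

/-! ### Sums over the edges of a matching -/

variable {𝒜}

theorem sum_edges_buyer {M : Finset (Fin n × Fin m)} (hM : M ∈ 𝒜.feasible) (f : Fin n → ℝ) :
    ∑ e ∈ M, f e.1 = ∑ i, if ∃ j, (i, j) ∈ M then f i else 0 := by
  have hinj : Set.InjOn Prod.fst (M : Set (Fin n × Fin m)) := by
    rintro ⟨i, j⟩ h ⟨i', j'⟩ h' rfl
    rw [𝒜.feasible_matching_buyer M hM i j j' h h']
  rw [← sum_filter, ← sum_image (f := f) hinj]
  refine sum_congr ?_ fun _ _ => rfl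
  ext i
  simp

theorem sum_edges_seller {M : Finset (Fin n × Fin m)} (hM : M ∈ 𝒜.feasible) (g : Fin m → ℝ) :
    ∑ e ∈ M, g e.2 = ∑ j, if ∃ i, (i, j) ∈ M then g j else 0 := by
  have hinj : Set.InjOn Prod.snd (M : Set (Fin n × Fin m)) := by
    rintro ⟨i, j⟩ h ⟨i', j'⟩ h' rfl
    rw [𝒜.feasible_matching_seller M hM i i' j h h']
  rw [← sum_filter, ← sum_image (f := g) hinj]
  refine sum_congr ?_ fun _ _ => rfl
  ext j
  simp

namespace Mechanism

/-- The expected weight of the lottery, for weights that are a difference of a buyer term and a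
seller term, depends only on the trading probabilities. -/
theorem lottery_weight (X : 𝒜.Mechanism) (b : 𝒜.BProf) (s : 𝒜.SProf) (f : Fin n → ℝ)
    (g : Fin m → ℝ) :
    ∑ M ∈ 𝒜.feasible, X.lottery b s M * ∑ e ∈ M, (f e.1 - g e.2) =
      ∑ i, f i * X.xB b s i - ∑ j, g j * X.xS b s j := by
  have hB : ∑ i, f i * X.xB b s i =
      ∑ M ∈ 𝒜.feasible, X.lottery b s M * ∑ i, if ∃ j, (i, j) ∈ M then f i else 0 := by
    simp only [xB, mul_sum, sum_filter]
    rw [sum_comm]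
    exact sum_congr rfl fun M _ => sum_congr rfl fun i _ => by split_ifs <;> ring
  have hS : ∑ j, g j * X.xS b s j =
      ∑ M ∈ 𝒜.feasible, X.lottery b s M * ∑ j, if ∃ i, (i, j) ∈ M then g j else 0 := by
    simp only [xS, mul_sum, sum_filter]
    rw [sum_comm]
    exact sum_congr rfl fun M _ => sum_congr rfl fun i _ => by split_ifs <;> ring
  rw [hB, hS, ← sum_sub_distrib]
  refine sum_congr rfl fun M hM => ?_
  rw [sum_sub_distrib, sum_edges_buyer hM, sum_edges_seller hM, mul_sub]

theorem GFT_eq (X : 𝒜.Mechanism) : X.GFT =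
    𝒜.expect fun b s => ∑ i, (b i : ℝ) * X.xB b s i - ∑ j, (s j : ℝ) * X.xS b s j := by
  unfold GFT
  congr 1
  funext b s
  exact X.lottery_weight b s (fun i => b i) (fun j => s j)

theorem ExPostIR.interimIR {X : 𝒜.Mechanism} (h : X.ExPostIR) : X.InterimIR := by
  refine ⟨fun i t => 𝒜.expect_nonneg fun b s => ?_, fun j t => 𝒜.expect_nonneg fun b s => ?_⟩
  · simpa using (h (Function.update b i t) s).1 i
  · simpa using (h b (Function.update s j t)).2 j

theorem DSIC.bic {X : 𝒜.Mechanism} (h : X.DSIC) : X.BIC := by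
  refine ⟨fun i t t' => 𝒜.expect_mono fun b s => ?_, fun j t t' => 𝒜.expect_mono fun b s => ?_⟩
  · simpa using (h (Function.update b i t) s).1 i t'
  · simpa using (h b (Function.update s j t)).2 j t'

theorem interimB_eq (X : 𝒜.Mechanism) (i : Fin n) (t t' : (𝒜.buyerDist i).Ty) :
    X.interimB i t t' = t * 𝒜.expect (fun b s => X.xB (Function.update b i t') s i) -
      𝒜.expect (fun b s => X.payB (Function.update b i t') s i) := by
  rw [← expect_mul_left, ← expect_sub]
  rfl

theorem interimS_eq (X : 𝒜.Mechanism) (j : Fin m) (t t' : (𝒜.sellerDist j).Ty) :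
    X.interimS j t t' = 𝒜.expect (fun b s => X.payS b (Function.update s j t') j) -
      t * 𝒜.expect (fun b s => X.xS b (Function.update s j t') j) := by
  rw [← expect_mul_left, ← expect_sub]
  rfl

/-- In an interim IR and BIC mechanism, a buyer's expected payment is at most her expected
ironed virtual value from trading. -/
theorem expect_payB_le {X : 𝒜.Mechanism} (hir : X.InterimIR) (hic : X.BIC) (i : Fin n) :
    𝒜.expect (fun b s => X.payB b s i) ≤
      𝒜.expect fun b s => (𝒜.buyerDist i).buyerVirtual (b i) * X.xB b s i := by
  set D := 𝒜.buyerDist i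
  set x : D.Ty → ℝ := fun t => 𝒜.expect (fun b s => X.xB (Function.update b i t) s i)
  set p : D.Ty → ℝ := fun t => 𝒜.expect (fun b s => X.payB (Function.update b i t) s i)
  have hp : 𝒜.expect (fun b s => X.payB b s i) = ∑ t : D.Ty, D.mass t * p t := by
    rw [𝒜.expect_resampleB i, expect_sum]
    exact sum_congr rfl fun t _ => 𝒜.expect_mul_left _ _
  have hx : 𝒜.expect (fun b s => D.buyerVirtual (b i) * X.xB b s i) =
      ∑ t : D.Ty, D.mass t * (D.buyerVirtual t * x t) := by
    rw [𝒜.expect_resampleB i, expect_sum]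
    refine sum_congr rfl fun t _ => ?_
    simp only [Function.update_self]
    rw [expect_mul_left, expect_mul_left]
  rw [hp, hx]
  -- extended by `0` off the support, where nothing is summed or assumed
  have hext : ∀ (f : D.Ty → ℝ) (t : D.Ty), Function.extend Subtype.val f 0 (t : ℝ) = f t :=
    fun f t => Subtype.val_injective.extend_apply f 0 t
  have key := D.payment_le_virtual (Function.extend Subtype.val x 0)
    (Function.extend Subtype.val p 0)
    (fun t ht => by
      have := hir.1 i ⟨t, ht⟩
      rw [interimB_eq] at this
      rwa [hext x ⟨t, ht⟩, hext p ⟨t, ht⟩])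
    (fun t ht t' ht' => by
      have := hic.1 i ⟨t, ht⟩ ⟨t', ht'⟩
      rw [interimB_eq, interimB_eq] at this
      rwa [hext x ⟨t, ht⟩, hext p ⟨t, ht⟩, hext x ⟨t', ht'⟩, hext p ⟨t', ht'⟩])
  rw [← sum_coe_sort D.supp, ← sum_coe_sort D.supp] at key
  simpa only [hext] using key

/-- In an interim IR and BIC mechanism, a seller's expected gain is at least her expected ironed
virtual cost from trading. -/
theorem le_expect_payS {X : 𝒜.Mechanism} (hir : X.InterimIR) (hic : X.BIC) (j : Fin m) :
    𝒜.expect (fun b s => (𝒜.sellerDist j).sellerVirtual (s j) * X.xS b s j) ≤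
      𝒜.expect (fun b s => X.payS b s j) := by
  set D := 𝒜.sellerDist j
  set x : D.Ty → ℝ := fun t => 𝒜.expect (fun b s => X.xS b (Function.update s j t) j)
  set p : D.Ty → ℝ := fun t => 𝒜.expect (fun b s => X.payS b (Function.update s j t) j)
  have hp : 𝒜.expect (fun b s => X.payS b s j) = ∑ t : D.Ty, D.mass t * p t := by
    rw [𝒜.expect_resampleS j, expect_sum]
    exact sum_congr rfl fun t _ => 𝒜.expect_mul_left _ _
  have hx : 𝒜.expect (fun b s => D.sellerVirtual (s j) * X.xS b s j) =
      ∑ t : D.Ty, D.mass t * (D.sellerVirtual t * x t) := by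
    rw [𝒜.expect_resampleS j, expect_sum]
    refine sum_congr rfl fun t _ => ?_
    simp only [Function.update_self]
    rw [expect_mul_left, expect_mul_left]
  rw [hp, hx]
  -- extended by `0` off the support, where nothing is summed or assumed
  have hext : ∀ (f : D.Ty → ℝ) (t : D.Ty), Function.extend Subtype.val f 0 (t : ℝ) = f t :=
    fun f t => Subtype.val_injective.extend_apply f 0 t
  have key := D.virtual_le_gain (Function.extend Subtype.val x 0)
    (Function.extend Subtype.val p 0)
    (fun t ht => by
      have := hir.2 j ⟨t, ht⟩
      rw [interimS_eq] at this
      rwa [hext x ⟨t, ht⟩, hext p ⟨t, ht⟩])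
    (fun t ht t' ht' => by
      have := hic.2 j ⟨t, ht⟩ ⟨t', ht'⟩
      rw [interimS_eq, interimS_eq] at this
      rwa [hext x ⟨t, ht⟩, hext p ⟨t, ht⟩, hext x ⟨t', ht'⟩, hext p ⟨t', ht'⟩])
  rw [← sum_coe_sort D.supp, ← sum_coe_sort D.supp] at key
  simpa only [hext] using key

end Mechanism

/-! ### Maximum weight matchings -/

theorem maxWeightMatching_mem (rank : Finset (Fin n × Fin m) ↪ ℕ) (w : Fin n × Fin m → ℝ) :
    𝒜.maxWeightMatching rank w ∈ 𝒜.feasible :=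
  (𝒜.exists_maxWeightMatching rank w).choose_spec.1

theorem weight_le_maxWeightMatching (rank : Finset (Fin n × Fin m) ↪ ℕ) (w : Fin n × Fin m → ℝ)
    {M : Finset (Fin n × Fin m)} (hM : M ∈ 𝒜.feasible) :
    ∑ e ∈ M, w e ≤ ∑ e ∈ 𝒜.maxWeightMatching rank w, w e :=
  (𝒜.exists_maxWeightMatching rank w).choose_spec.2.1 M hM

theorem rank_maxWeightMatching_le (rank : Finset (Fin n × Fin m) ↪ ℕ) (w : Fin n × Fin m → ℝ)
    {M : Finset (Fin n × Fin m)} (hM : M ∈ 𝒜.feasible)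
    (h : ∑ e ∈ M, w e = ∑ e ∈ 𝒜.maxWeightMatching rank w, w e) :
    rank (𝒜.maxWeightMatching rank w) ≤ rank M :=
  (𝒜.exists_maxWeightMatching rank w).choose_spec.2.2 M hM h

/-- If the matchings with property `P` all gain the same nonnegative weight and the selected
matching has property `P`, then the same matching is selected after the change. -/
theorem maxWeightMatching_eq_of_boost (rank : Finset (Fin n × Fin m) ↪ ℕ)
    {w w' : Fin n × Fin m → ℝ} {c : ℝ} (hc : 0 ≤ c) (P : Finset (Fin n × Fin m) → Prop)
    [DecidablePred P]
    (hw : ∀ M ∈ 𝒜.feasible, ∑ e ∈ M, w' e = ∑ e ∈ M, w e + if P M then c else 0)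
    (hP : P (𝒜.maxWeightMatching rank w)) :
    𝒜.maxWeightMatching rank w' = 𝒜.maxWeightMatching rank w := by
  have hM := maxWeightMatching_mem (𝒜 := 𝒜) rank w
  have hM' := maxWeightMatching_mem (𝒜 := 𝒜) rank w'
  have h1 := weight_le_maxWeightMatching rank w hM'
  have h2 := weight_le_maxWeightMatching rank w' hM
  have e1 := hw _ hM
  have e2 := hw _ hM'
  rw [if_pos hP] at e1
  have hle : (if P (𝒜.maxWeightMatching rank w') then c else 0) ≤ c := by
    split_ifs
    exacts [le_rfl, hc]
  refine rank.injective (le_antisymm ?_ ?_)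
  · exact rank_maxWeightMatching_le rank w' hM (by linarith)
  · exact rank_maxWeightMatching_le rank w hM' (by linarith)

/-- Since feasibility is downward closed, no selected edge has negative weight. -/
theorem weight_nonneg_of_mem_maxWeightMatching (rank : Finset (Fin n × Fin m) ↪ ℕ)
    (w : Fin n × Fin m → ℝ) {e : Fin n × Fin m} (he : e ∈ 𝒜.maxWeightMatching rank w) :
    0 ≤ w e := by
  have h := weight_le_maxWeightMatching rank w (𝒜.feasible_downward_closed _
    (maxWeightMatching_mem rank w) _ (erase_subset e _))
  rw [← add_sum_erase _ _ he] at h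
  linarith

/-! ### Matching mechanisms with threshold payments -/

/-- Edge weights that are a difference of transformed reports: `f i` is applied to the report of
buyer `i` and `g j` to that of seller `j`. -/
def separableWeight (𝒜 : DoubleAuction n m) (f : Fin n → ℝ → ℝ) (g : Fin m → ℝ → ℝ)
    (b : 𝒜.BProf) (s : 𝒜.SProf) (e : Fin n × Fin m) : ℝ :=
  f e.1 (b e.1) - g e.2 (s e.2)

section Separable

variable (rank : Finset (Fin n × Fin m) ↪ ℕ) {f : Fin n → ℝ → ℝ} {g : Fin m → ℝ → ℝ}

/-- A trading buyer who raises her transformed report does not change the selected matching. -/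
theorem maxWeightMatching_updateB (b : 𝒜.BProf) (s : 𝒜.SProf) (i : Fin n)
    {t t' : (𝒜.buyerDist i).Ty} (h : f i t ≤ f i t')
    (ht : ∃ j, (i, j) ∈ 𝒜.maxWeightMatching rank
      (𝒜.separableWeight f g (Function.update b i t) s)) :
    𝒜.maxWeightMatching rank (𝒜.separableWeight f g (Function.update b i t') s) =
      𝒜.maxWeightMatching rank (𝒜.separableWeight f g (Function.update b i t) s) := by
  refine maxWeightMatching_eq_of_boost rank (sub_nonneg.2 h) (fun M => ∃ j, (i, j) ∈ M)
    (fun M hM => ?_) ht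
  have hc := sum_edges_buyer hM fun k => if k = i then f i t' - f i t else 0
  have hc' : (∑ k, if ∃ j, (k, j) ∈ M then (if k = i then f i t' - f i t else 0) else 0) =
      if ∃ j, (i, j) ∈ M then f i t' - f i t else 0 := by
    rw [sum_eq_single i] <;> simp +contextual
  rw [← hc', ← hc, ← sum_add_distrib]
  refine sum_congr rfl fun e _ => ?_
  unfold separableWeight
  split_ifs with hi
  · subst hi
    simp only [Function.update_self]
    ring
  · simp [Function.update_of_ne hi]

/-- A trading seller who lowers her transformed report does not change the selected matching. -/
theorem maxWeightMatching_updateS (b : 𝒜.BProf) (s : 𝒜.SProf) (j : Fin m)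
    {t t' : (𝒜.sellerDist j).Ty} (h : g j t' ≤ g j t)
    (ht : ∃ i, (i, j) ∈ 𝒜.maxWeightMatching rank
      (𝒜.separableWeight f g b (Function.update s j t))) :
    𝒜.maxWeightMatching rank (𝒜.separableWeight f g b (Function.update s j t')) =
      𝒜.maxWeightMatching rank (𝒜.separableWeight f g b (Function.update s j t)) := by
  refine maxWeightMatching_eq_of_boost rank (sub_nonneg.2 h) (fun M => ∃ i, (i, j) ∈ M)
    (fun M hM => ?_) ht
  have hc := sum_edges_seller hM fun k => if k = j then g j t - g j t' else 0
  have hc' : (∑ k, if ∃ i, (i, k) ∈ M then (if k = j then g j t - g j t' else 0) else 0) =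
      if ∃ i, (i, j) ∈ M then g j t - g j t' else 0 := by
    rw [sum_eq_single j] <;> simp +contextual
  rw [← hc', ← hc, ← sum_add_distrib]
  refine sum_congr rfl fun e _ => ?_
  unfold separableWeight
  split_ifs with hi
  · subst hi
    simp only [Function.update_self]
    ring
  · simp [Function.update_of_ne hi]

theorem matchingMechanism_xB (w : 𝒜.BProf → 𝒜.SProf → Fin n × Fin m → ℝ) (b : 𝒜.BProf)
    (s : 𝒜.SProf) (i : Fin n) : (𝒜.matchingMechanism rank w).xB b s i =
      if ∃ j, (i, j) ∈ 𝒜.maxWeightMatching rank (w b s) then 1 else 0 := by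
  simp only [Mechanism.xB, matchingMechanism, sum_ite_eq', mem_filter, maxWeightMatching_mem,
    true_and]

theorem matchingMechanism_xS (w : 𝒜.BProf → 𝒜.SProf → Fin n × Fin m → ℝ) (b : 𝒜.BProf)
    (s : 𝒜.SProf) (j : Fin m) : (𝒜.matchingMechanism rank w).xS b s j =
      if ∃ i, (i, j) ∈ 𝒜.maxWeightMatching rank (w b s) then 1 else 0 := by
  simp only [Mechanism.xS, matchingMechanism, sum_ite_eq', mem_filter, maxWeightMatching_mem,
    true_and]

/-- With the other reports fixed, a buyer either never trades and never pays, or faces a posted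
price `θ` in her support, which is minimal among the types with the same transformed value. -/
theorem exists_postedPriceB
    (hf : ∀ i, ∀ t t' : (𝒜.buyerDist i).Ty, t ≤ t' → f i t ≤ f i t')
    (b : 𝒜.BProf) (s : 𝒜.SProf) (i : Fin n) :
    let X := 𝒜.matchingMechanism rank (𝒜.separableWeight f g)
    (∀ t, X.xB (Function.update b i t) s i = 0 ∧ X.payB (Function.update b i t) s i = 0) ∨
    ∃ θ : (𝒜.buyerDist i).Ty,
      (∀ t, X.xB (Function.update b i t) s i = if θ ≤ t then 1 else 0) ∧
      (∀ t, X.payB (Function.update b i t) s i = if θ ≤ t then (θ : ℝ) else 0) ∧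
      ∀ t, t < θ → f i t < f i θ := by
  intro X
  set A : 𝒜.BProf → 𝒜.SProf → Finset (Fin n × Fin m) := fun b s =>
    𝒜.maxWeightMatching rank (𝒜.separableWeight f g b s) with hA
  have hx : ∀ t, X.xB (Function.update b i t) s i =
      if ∃ j, (i, j) ∈ A (Function.update b i t) s then 1 else 0 :=
    fun t => matchingMechanism_xB rank _ _ _ _
  have hp : ∀ t, X.payB (Function.update b i t) s i =
      𝒜.thresholdB A (Function.update b i t) s i := fun t => rfl
  simp only [hx, hp]
  by_cases hne : (univ.filter fun t : (𝒜.buyerDist i).Ty =>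
      ∃ j, (i, j) ∈ A (Function.update b i t) s).Nonempty
  · right
    set θ := (univ.filter fun t : (𝒜.buyerDist i).Ty =>
      ∃ j, (i, j) ∈ A (Function.update b i t) s).min' hne with hθ
    have hmem := min'_mem _ hne
    rw [← hθ, mem_filter] at hmem
    have hup : ∀ t : (𝒜.buyerDist i).Ty, f i θ ≤ f i t → ∃ j, (i, j) ∈ A (Function.update b i t) s := fun t ht => by
      simp only [hA]
      rw [maxWeightMatching_updateB rank b s i ht hmem.2]
      exact hmem.2
    have hlow : ∀ t, (∃ j, (i, j) ∈ A (Function.update b i t) s) → θ ≤ t := fun t ht =>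
      min'_le _ _ (by simpa using ht)
    have hiff : ∀ t, (∃ j, (i, j) ∈ A (Function.update b i t) s) ↔ θ ≤ t := fun t =>
      ⟨hlow t, fun h => hup t (hf i _ _ h)⟩
    refine ⟨θ, fun t => by simp only [hiff], fun t => ?_, fun t ht => ?_⟩
    · by_cases h : ∃ j, (i, j) ∈ A (Function.update b i t) s
      · rw [thresholdB, dif_pos h, if_pos ((hiff t).1 h)]
        simp only [Function.update_idem]
        rfl
      · rw [thresholdB, dif_neg h, if_neg (fun h' => h ((hiff t).2 h'))]
    · by_contra! hle
      exact (hlow t (hup t hle)).not_gt ht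
  · left
    intro t
    have h : ¬∃ j, (i, j) ∈ A (Function.update b i t) s := fun h => hne ⟨t, by simpa using h⟩
    exact ⟨if_neg h, by rw [thresholdB, dif_neg h]⟩

/-- With the other reports fixed, a seller either never trades and never gains, or faces a posted
price `θ` in her support, which is maximal among the types with the same transformed value. -/
theorem exists_postedPriceS
    (hg : ∀ j, ∀ t t' : (𝒜.sellerDist j).Ty, t ≤ t' → g j t ≤ g j t')
    (b : 𝒜.BProf) (s : 𝒜.SProf) (j : Fin m) :
    let X := 𝒜.matchingMechanism rank (𝒜.separableWeight f g)
    (∀ t, X.xS b (Function.update s j t) j = 0 ∧ X.payS b (Function.update s j t) j = 0) ∨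
    ∃ θ : (𝒜.sellerDist j).Ty,
      (∀ t, X.xS b (Function.update s j t) j = if t ≤ θ then 1 else 0) ∧
      (∀ t, X.payS b (Function.update s j t) j = if t ≤ θ then (θ : ℝ) else 0) ∧
      ∀ t, θ < t → g j θ < g j t := by
  intro X
  set A : 𝒜.BProf → 𝒜.SProf → Finset (Fin n × Fin m) := fun b s =>
    𝒜.maxWeightMatching rank (𝒜.separableWeight f g b s) with hA
  have hx : ∀ t, X.xS b (Function.update s j t) j =
      if ∃ i, (i, j) ∈ A b (Function.update s j t) then 1 else 0 :=
    fun t => matchingMechanism_xS rank _ _ _ _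
  have hp : ∀ t, X.payS b (Function.update s j t) j =
      𝒜.thresholdS A b (Function.update s j t) j := fun t => rfl
  simp only [hx, hp]
  by_cases hne : (univ.filter fun t : (𝒜.sellerDist j).Ty =>
      ∃ i, (i, j) ∈ A b (Function.update s j t)).Nonempty
  · right
    set θ := (univ.filter fun t : (𝒜.sellerDist j).Ty =>
      ∃ i, (i, j) ∈ A b (Function.update s j t)).max' hne with hθ
    have hmem := max'_mem _ hne
    rw [← hθ, mem_filter] at hmem
    have hup : ∀ t : (𝒜.sellerDist j).Ty, g j t ≤ g j θ → ∃ i, (i, j) ∈ A b (Function.update s j t) := fun t ht => by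
      simp only [hA]
      rw [maxWeightMatching_updateS rank b s j ht hmem.2]
      exact hmem.2
    have hlow : ∀ t, (∃ i, (i, j) ∈ A b (Function.update s j t)) → t ≤ θ := fun t ht =>
      le_max' _ _ (by simpa using ht)
    have hiff : ∀ t, (∃ i, (i, j) ∈ A b (Function.update s j t)) ↔ t ≤ θ := fun t =>
      ⟨hlow t, fun h => hup t (hg j _ _ h)⟩
    refine ⟨θ, fun t => by simp only [hiff], fun t => ?_, fun t ht => ?_⟩
    · by_cases h : ∃ i, (i, j) ∈ A b (Function.update s j t)
      · rw [thresholdS, dif_pos h, if_pos ((hiff t).1 h)]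
        simp only [Function.update_idem]
        rfl
      · rw [thresholdS, dif_neg h, if_neg (fun h' => h ((hiff t).2 h'))]
    · by_contra! hle
      exact (hlow t (hup t hle)).not_gt ht
  · left
    intro t
    have h : ¬∃ i, (i, j) ∈ A b (Function.update s j t) := fun h => hne ⟨t, by simpa using h⟩
    exact ⟨if_neg h, by rw [thresholdS, dif_neg h]⟩

theorem matchingMechanism_exPostIR
    (hf : ∀ i, ∀ t t' : (𝒜.buyerDist i).Ty, t ≤ t' → f i t ≤ f i t')
    (hg : ∀ j, ∀ t t' : (𝒜.sellerDist j).Ty, t ≤ t' → g j t ≤ g j t') :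
    (𝒜.matchingMechanism rank (𝒜.separableWeight f g)).ExPostIR := by
  refine fun b s => ⟨fun i => ?_, fun j => ?_⟩
  · unfold Mechanism.utilB
    rcases exists_postedPriceB rank (g := g) hf b s i with h | ⟨θ, hx, hp, -⟩
    · have h' := h (b i)
      rw [Function.update_eq_self] at h'
      simp [h']
    · have hx' := hx (b i)
      have hp' := hp (b i)
      rw [Function.update_eq_self] at hx' hp'
      rw [hx', hp']
      split_ifs with hle
      · simpa using hle
      · simp
  · unfold Mechanism.utilS
    rcases exists_postedPriceS rank (f := f) hg b s j with h | ⟨θ, hx, hp, -⟩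
    · have h' := h (s j)
      rw [Function.update_eq_self] at h'
      simp [h']
    · have hx' := hx (s j)
      have hp' := hp (s j)
      rw [Function.update_eq_self] at hx' hp'
      rw [hx', hp']
      split_ifs with hle
      · simpa using hle
      · simp

theorem matchingMechanism_dsic
    (hf : ∀ i, ∀ t t' : (𝒜.buyerDist i).Ty, t ≤ t' → f i t ≤ f i t')
    (hg : ∀ j, ∀ t t' : (𝒜.sellerDist j).Ty, t ≤ t' → g j t ≤ g j t') :
    (𝒜.matchingMechanism rank (𝒜.separableWeight f g)).DSIC := by
  refine fun b s => ⟨fun i t' => ?_, fun j t' => ?_⟩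
  · unfold Mechanism.utilB
    rcases exists_postedPriceB rank (g := g) hf b s i with h | ⟨θ, hx, hp, -⟩
    · have h' := h (b i)
      rw [Function.update_eq_self] at h'
      simp [h, h']
    · have hx' := hx (b i)
      have hp' := hp (b i)
      rw [Function.update_eq_self] at hx' hp'
      rw [hx', hp', hx, hp]
      simp only [← Subtype.coe_le_coe]
      split_ifs <;> linarith
  · unfold Mechanism.utilS
    rcases exists_postedPriceS rank (f := f) hg b s j with h | ⟨θ, hx, hp, -⟩
    · have h' := h (s j)
      rw [Function.update_eq_self] at h'
      simp [h, h']
    · have hx' := hx (s j)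
      have hp' := hp (s j)
      rw [Function.update_eq_self] at hx' hp'
      rw [hx', hp', hx, hp]
      simp only [← Subtype.coe_le_coe]
      split_ifs <;> linarith

/-- If buyers are screened by their ironed virtual values, each buyer's expected payment is her
expected ironed virtual value from trading. -/
theorem expect_payB_eq (hf : ∀ i, f i = (𝒜.buyerDist i).buyerVirtual) (i : Fin n) :
    let X := 𝒜.matchingMechanism rank (𝒜.separableWeight f g)
    𝒜.expect (fun b s => X.payB b s i) = 𝒜.expect fun b s => f i (b i) * X.xB b s i := by
  intro X
  rw [𝒜.expect_resampleB i, 𝒜.expect_resampleB i fun b s => f i (b i) * X.xB b s i]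
  congr 1
  funext b s
  simp only [Function.update_self]
  have hmono : ∀ i, ∀ t t' : (𝒜.buyerDist i).Ty, t ≤ t' → f i t ≤ f i t' := fun i t t' h => by
    rw [hf]
    exact FinDist.buyerVirtual_mono _ t.2 t'.2 h
  rcases exists_postedPriceB rank (g := g) hmono b s i with h | ⟨θ, hx, hp, hjump⟩
  · exact sum_congr rfl fun t _ => by rw [(h t).1, (h t).2, mul_zero, mul_zero, mul_zero]
  · have key := (𝒜.buyerDist i).sum_virtual_eq_price θ.2 fun r hr hlt => by
      simpa only [hf] using hjump ⟨r, hr⟩ hlt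
    rw [FinDist.upper, mul_sum, sum_filter, sum_filter, ← sum_coe_sort (𝒜.buyerDist i).supp,
      ← sum_coe_sort (𝒜.buyerDist i).supp] at key
    refine (sum_congr rfl fun t _ => ?_).trans (key.symm.trans (sum_congr rfl fun t _ => ?_))
    · rw [hp]
      simp only [← Subtype.coe_le_coe]
      split_ifs <;> ring
    · rw [hx, hf]
      simp only [← Subtype.coe_le_coe]
      split_ifs <;> ring

/-- If sellers are screened by their ironed virtual costs, each seller's expected gain is her
expected ironed virtual cost from trading. -/
theorem expect_payS_eq (hg : ∀ j, g j = (𝒜.sellerDist j).sellerVirtual) (j : Fin m) :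
    let X := 𝒜.matchingMechanism rank (𝒜.separableWeight f g)
    𝒜.expect (fun b s => X.payS b s j) = 𝒜.expect fun b s => g j (s j) * X.xS b s j := by
  intro X
  rw [𝒜.expect_resampleS j, 𝒜.expect_resampleS j fun b s => g j (s j) * X.xS b s j]
  congr 1
  funext b s
  simp only [Function.update_self]
  have hmono : ∀ j, ∀ t t' : (𝒜.sellerDist j).Ty, t ≤ t' → g j t ≤ g j t' := fun j t t' h => by
    rw [hg]
    exact FinDist.sellerVirtual_mono _ t.2 t'.2 h
  rcases exists_postedPriceS rank (f := f) hmono b s j with h | ⟨θ, hx, hp, hjump⟩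
  · exact sum_congr rfl fun t _ => by rw [(h t).1, (h t).2, mul_zero, mul_zero, mul_zero]
  · have key := (𝒜.sellerDist j).sum_sellerVirtual_eq_price θ.2 fun r hr hlt => by
      simpa only [hg] using hjump ⟨r, hr⟩ hlt
    rw [FinDist.cdf, mul_sum, sum_filter, sum_filter, ← sum_coe_sort (𝒜.sellerDist j).supp,
      ← sum_coe_sort (𝒜.sellerDist j).supp] at key
    refine (sum_congr rfl fun t _ => ?_).trans (key.symm.trans (sum_congr rfl fun t _ => ?_))
    · rw [hp]
      simp only [← Subtype.coe_le_coe]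
      split_ifs <;> ring
    · rw [hx, hg]
      simp only [← Subtype.coe_le_coe]
      split_ifs <;> ring

theorem sum_edges_buyer_eq (b : 𝒜.BProf) (s : 𝒜.SProf) (h : Fin n → ℝ) :
    ∑ e ∈ 𝒜.maxWeightMatching rank (𝒜.separableWeight f g b s), h e.1 =
      ∑ i, h i * (𝒜.matchingMechanism rank (𝒜.separableWeight f g)).xB b s i := by
  simp only [matchingMechanism_xB, mul_ite, mul_one, mul_zero]
  exact sum_edges_buyer (maxWeightMatching_mem rank _) h

theorem sum_edges_seller_eq (b : 𝒜.BProf) (s : 𝒜.SProf) (h : Fin m → ℝ) :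
    ∑ e ∈ 𝒜.maxWeightMatching rank (𝒜.separableWeight f g b s), h e.2 =
      ∑ j, h j * (𝒜.matchingMechanism rank (𝒜.separableWeight f g)).xS b s j := by
  simp only [matchingMechanism_xS, mul_ite, mul_one, mul_zero]
  exact sum_edges_seller (maxWeightMatching_mem rank _) h

/-- If sellers enter with their true costs, the gain of a trading seller is at most the
transformed value of her partner: reporting her threshold would not change the matching, and
selected edges have nonnegative weight. -/
theorem sum_payS_le (hg : ∀ j t, g j t = t) (b : 𝒜.BProf) (s : 𝒜.SProf) :
    let X := 𝒜.matchingMechanism rank (𝒜.separableWeight f g)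
    ∑ j, X.payS b s j ≤ ∑ i, f i (b i) * X.xB b s i := by
  intro X
  rw [← sum_edges_buyer_eq rank b s fun i => f i (b i)]
  have hmono : ∀ j, ∀ t t' : (𝒜.sellerDist j).Ty, t ≤ t' → g j t ≤ g j t' := fun j t t' h => by
    simpa only [hg, Subtype.coe_le_coe] using h
  have hpay : ∑ j, X.payS b s j = ∑ j, X.payS b s j * X.xS b s j := by
    refine sum_congr rfl fun j _ => ?_
    rcases exists_postedPriceS rank (f := f) hmono b s j with h | ⟨θ, hx, hp, -⟩
    · have h' := h (s j)
      rw [Function.update_eq_self] at h'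
      simp [X, h']
    · have hx' := hx (s j)
      have hp' := hp (s j)
      rw [Function.update_eq_self] at hx' hp'
      simp only [X]
      rw [hx', hp']
      split_ifs <;> simp
  rw [hpay, ← sum_edges_seller_eq rank b s fun j => X.payS b s j]
  refine sum_le_sum fun e he => ?_
  have hxe := matchingMechanism_xS rank (𝒜.separableWeight f g) b s e.2
  rw [if_pos ⟨e.1, he⟩] at hxe
  rcases exists_postedPriceS rank (f := f) hmono b s e.2 with h | ⟨θ, hx, hp, -⟩
  · have h' := (h (s e.2)).1
    rw [Function.update_eq_self, hxe] at h'
    exact (one_ne_zero h').elim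
  · have hx' := hx (s e.2)
    have hp' := hp (s e.2)
    rw [Function.update_eq_self] at hx' hp'
    rw [hxe] at hx'
    have hle : s e.2 ≤ θ := by
      by_contra hlt
      simp [hlt] at hx'
    have htrade : ∃ i, (i, e.2) ∈ 𝒜.maxWeightMatching rank
        (𝒜.separableWeight f g b (Function.update s e.2 θ)) := by
      have hθ := hx θ
      rw [matchingMechanism_xS, if_pos le_rfl] at hθ
      by_contra hno
      simp [hno] at hθ
    have hsame := maxWeightMatching_updateS rank b s e.2 (hmono _ _ _ hle) htrade
    rw [Function.update_eq_self] at hsame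
    rw [hsame] at he
    have hw := weight_nonneg_of_mem_maxWeightMatching rank _ he
    simp only [separableWeight, Function.update_self, hg] at hw
    simp only [X]
    rw [hp', if_pos hle]
    linarith

/-- If buyers enter with their true values, the payment of a trading buyer is at least the
transformed cost of her partner. -/
theorem le_sum_payB (hf : ∀ i t, f i t = t) (b : 𝒜.BProf) (s : 𝒜.SProf) :
    let X := 𝒜.matchingMechanism rank (𝒜.separableWeight f g)
    ∑ j, g j (s j) * X.xS b s j ≤ ∑ i, X.payB b s i := by
  intro X
  rw [← sum_edges_seller_eq rank b s fun j => g j (s j)]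
  have hmono : ∀ i, ∀ t t' : (𝒜.buyerDist i).Ty, t ≤ t' → f i t ≤ f i t' := fun i t t' h => by
    simpa only [hf, Subtype.coe_le_coe] using h
  have hpay : ∑ i, X.payB b s i = ∑ i, X.payB b s i * X.xB b s i := by
    refine sum_congr rfl fun i _ => ?_
    rcases exists_postedPriceB rank (g := g) hmono b s i with h | ⟨θ, hx, hp, -⟩
    · have h' := h (b i)
      rw [Function.update_eq_self] at h'
      simp [X, h']
    · have hx' := hx (b i)
      have hp' := hp (b i)
      rw [Function.update_eq_self] at hx' hp'
      simp only [X]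
      rw [hx', hp']
      split_ifs <;> simp
  rw [hpay, ← sum_edges_buyer_eq rank b s fun i => X.payB b s i]
  refine sum_le_sum fun e he => ?_
  have hxe := matchingMechanism_xB rank (𝒜.separableWeight f g) b s e.1
  rw [if_pos ⟨e.2, he⟩] at hxe
  rcases exists_postedPriceB rank (g := g) hmono b s e.1 with h | ⟨θ, hx, hp, -⟩
  · have h' := (h (b e.1)).1
    rw [Function.update_eq_self, hxe] at h'
    exact (one_ne_zero h').elim
  · have hx' := hx (b e.1)
    have hp' := hp (b e.1)
    rw [Function.update_eq_self] at hx' hp'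
    rw [hxe] at hx'
    have hle : θ ≤ b e.1 := by
      by_contra hlt
      simp [hlt] at hx'
    have htrade : ∃ j, (e.1, j) ∈ 𝒜.maxWeightMatching rank
        (𝒜.separableWeight f g (Function.update b e.1 θ) s) := by
      have hθ := hx θ
      rw [matchingMechanism_xB, if_pos le_rfl] at hθ
      by_contra hno
      simp [hno] at hθ
    have hsame := maxWeightMatching_updateB rank b s e.1 (hmono _ _ _ hle) htrade
    rw [Function.update_eq_self] at hsame
    rw [hsame] at he
    have hw := weight_nonneg_of_mem_maxWeightMatching rank _ he
    simp only [separableWeight, Function.update_self, hf] at hw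
    simp only [X]
    rw [hp', if_pos hle]
    linarith

/-- The selected matching has at least the expected weight of any lottery, and its gains from
trade are at least its weight if the transformation lowers values and raises costs. -/
theorem lottery_weight_le_GFT (Y : 𝒜.Mechanism)
    (hf : ∀ i, ∀ t ∈ (𝒜.buyerDist i).supp, f i t ≤ t)
    (hg : ∀ j, ∀ t ∈ (𝒜.sellerDist j).supp, t ≤ g j t) :
    𝒜.expect (fun b s => ∑ i, f i (b i) * Y.xB b s i - ∑ j, g j (s j) * Y.xS b s j) ≤
      (𝒜.matchingMechanism rank (𝒜.separableWeight f g)).GFT := by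
  rw [Mechanism.GFT_eq]
  refine 𝒜.expect_mono fun b s => ?_
  rw [← Y.lottery_weight b s (fun i => f i (b i)) (fun j => g j (s j)),
    ← sum_edges_buyer_eq, ← sum_edges_seller_eq, ← sum_sub_distrib]
  calc _ ≤ ∑ M ∈ 𝒜.feasible, Y.lottery b s M *
        ∑ e ∈ 𝒜.maxWeightMatching rank (𝒜.separableWeight f g b s),
          𝒜.separableWeight f g b s e :=
        sum_le_sum fun M hM => mul_le_mul_of_nonneg_left
          (weight_le_maxWeightMatching rank (𝒜.separableWeight f g b s) hM)
          (Y.lottery_nonneg b s M)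
    _ = ∑ e ∈ 𝒜.maxWeightMatching rank (𝒜.separableWeight f g b s),
          𝒜.separableWeight f g b s e := by rw [← sum_mul, Y.lottery_sum, one_mul]
    _ ≤ _ := sum_le_sum fun e _ =>
        sub_le_sub (hf e.1 _ (b e.1).2) (hg e.2 _ (s e.2).2)

end Separable

/-! ### The two offering mechanisms -/

variable (𝒜) (rank : Finset (Fin n × Fin m) ↪ ℕ)

theorem GSOM_eq : 𝒜.GSOM rank = 𝒜.matchingMechanism rank
    (𝒜.separableWeight (fun i => (𝒜.buyerDist i).buyerVirtual) fun _ t => t) := rfl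

theorem GBOM_eq : 𝒜.GBOM rank = 𝒜.matchingMechanism rank
    (𝒜.separableWeight (fun _ t => t) fun j => (𝒜.sellerDist j).sellerVirtual) := rfl

theorem GSOM_exPostIR : (𝒜.GSOM rank).ExPostIR :=
  matchingMechanism_exPostIR rank (f := fun i => (𝒜.buyerDist i).buyerVirtual) (g := fun _ t => t)
    (fun _ t t' h => FinDist.buyerVirtual_mono _ t.2 t'.2 h)
    fun _ _ _ h => h

theorem GSOM_dsic : (𝒜.GSOM rank).DSIC :=
  matchingMechanism_dsic rank (f := fun i => (𝒜.buyerDist i).buyerVirtual) (g := fun _ t => t)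
    (fun _ t t' h => FinDist.buyerVirtual_mono _ t.2 t'.2 h)
    fun _ _ _ h => h

theorem GSOM_exAnteWBB : (𝒜.GSOM rank).ExAnteWBB := by
  rw [GSOM_eq]
  unfold Mechanism.ExAnteWBB
  refine (𝒜.expect_mono fun b s => sum_payS_le rank (fun _ _ => rfl) b s).trans ?_
  rw [expect_sum, expect_sum]
  exact sum_le_sum fun i _ => (expect_payB_eq rank (fun _ => rfl) i).ge

theorem GBOM_exPostIR : (𝒜.GBOM rank).ExPostIR :=
  matchingMechanism_exPostIR rank (f := fun _ t => t) (g := fun j => (𝒜.sellerDist j).sellerVirtual)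
    (fun _ _ _ h => h)
    fun _ t t' h => FinDist.sellerVirtual_mono _ t.2 t'.2 h

theorem GBOM_dsic : (𝒜.GBOM rank).DSIC :=
  matchingMechanism_dsic rank (f := fun _ t => t) (g := fun j => (𝒜.sellerDist j).sellerVirtual)
    (fun _ _ _ h => h)
    fun _ t t' h => FinDist.sellerVirtual_mono _ t.2 t'.2 h

theorem GBOM_exAnteWBB : (𝒜.GBOM rank).ExAnteWBB := by
  rw [GBOM_eq]
  unfold Mechanism.ExAnteWBB
  refine le_trans ?_ (𝒜.expect_mono fun b s => le_sum_payB rank (fun _ _ => rfl) b s)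
  rw [expect_sum, expect_sum]
  exact sum_le_sum fun j _ => (expect_payS_eq rank (fun _ => rfl) j).le

/-- The gains from trade of an interim IR, BIC and ex-ante WBB mechanism are bounded by those of
the two offering mechanisms together: weak budget balance makes its expected virtual cost at most
its expected virtual value, so that replacing values by virtual values in one copy of its gains
from trade and costs by virtual costs in another loses at most one copy. -/
theorem GFT_le_add (rank₁ rank₂ : Finset (Fin n × Fin m) ↪ ℕ) {X : 𝒜.Mechanism}
    (hir : X.InterimIR) (hic : X.BIC) (hwbb : X.ExAnteWBB) :
    X.GFT ≤ (𝒜.GSOM rank₁).GFT + (𝒜.GBOM rank₂).GFT := by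
  have hS := lottery_weight_le_GFT rank₁ X (f := fun i => (𝒜.buyerDist i).buyerVirtual)
    (g := fun _ t => t) (fun i t ht => FinDist.buyerVirtual_le _ ht) fun _ _ _ => le_rfl
  have hB := lottery_weight_le_GFT rank₂ X (f := fun _ t => t)
    (g := fun j => (𝒜.sellerDist j).sellerVirtual) (fun _ _ _ => le_rfl)
    fun j t ht => FinDist.le_sellerVirtual _ ht
  rw [← GSOM_eq, expect_sub] at hS
  rw [← GBOM_eq, expect_sub] at hB
  rw [X.GFT_eq, expect_sub]
  have hpB : 𝒜.expect (fun b s => ∑ i, X.payB b s i) ≤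
      𝒜.expect fun b s => ∑ i, (𝒜.buyerDist i).buyerVirtual (b i) * X.xB b s i := by
    rw [expect_sum, expect_sum]
    exact sum_le_sum fun i _ => Mechanism.expect_payB_le hir hic i
  have hpS : 𝒜.expect (fun b s => ∑ j, (𝒜.sellerDist j).sellerVirtual (s j) * X.xS b s j) ≤
      𝒜.expect fun b s => ∑ j, X.payS b s j := by
    rw [expect_sum, expect_sum]
    exact sum_le_sum fun j _ => Mechanism.le_expect_payS hir hic j
  unfold Mechanism.ExAnteWBB at hwbb
  linarith

end DoubleAuction

end

theorem mainTheorem2 {n m : ℕ} (𝒜 : DoubleAuction n m)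
    (rank₁ rank₂ : Finset (Fin n × Fin m) ↪ ℕ) :
    ((𝒜.GSOM rank₁).ExPostIR ∧ (𝒜.GSOM rank₁).DSIC ∧ (𝒜.GSOM rank₁).ExAnteWBB) ∧
    ((𝒜.GBOM rank₂).ExPostIR ∧ (𝒜.GBOM rank₂).DSIC ∧ (𝒜.GBOM rank₂).ExAnteWBB) ∧
    IsLUB 𝒜.achievableGFT 𝒜.OPT ∧
    𝒜.OPT ≤ (𝒜.GSOM rank₁).GFT + (𝒜.GBOM rank₂).GFT ∧
    𝒜.OPT / 2 ≤ max (𝒜.GSOM rank₁).GFT (𝒜.GBOM rank₂).GFT ∧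
    (∃ X : 𝒜.Mechanism, X.ExPostIR ∧ X.DSIC ∧ X.ExAnteWBB ∧ 𝒜.OPT / 2 ≤ X.GFT) := by
  have hS : (𝒜.GSOM rank₁).ExPostIR ∧ (𝒜.GSOM rank₁).DSIC ∧ (𝒜.GSOM rank₁).ExAnteWBB :=
    ⟨𝒜.GSOM_exPostIR rank₁, 𝒜.GSOM_dsic rank₁, 𝒜.GSOM_exAnteWBB rank₁⟩
  have hB : (𝒜.GBOM rank₂).ExPostIR ∧ (𝒜.GBOM rank₂).DSIC ∧ (𝒜.GBOM rank₂).ExAnteWBB :=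
    ⟨𝒜.GBOM_exPostIR rank₂, 𝒜.GBOM_dsic rank₂, 𝒜.GBOM_exAnteWBB rank₂⟩
  have hne : 𝒜.achievableGFT.Nonempty := ⟨_, _, hS.1.interimIR, hS.2.1.bic, hS.2.2, rfl⟩
  have hub : (𝒜.GSOM rank₁).GFT + (𝒜.GBOM rank₂).GFT ∈ upperBounds 𝒜.achievableGFT := by
    rintro _ ⟨X, hir, hic, hwbb, rfl⟩
    exact 𝒜.GFT_le_add rank₁ rank₂ hir hic hwbb
  have hlub : IsLUB 𝒜.achievableGFT 𝒜.OPT := isLUB_csSup hne ⟨_, hub⟩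
  have hadd : 𝒜.OPT ≤ (𝒜.GSOM rank₁).GFT + (𝒜.GBOM rank₂).GFT := hlub.2 hub
  have hmax : 𝒜.OPT / 2 ≤ max (𝒜.GSOM rank₁).GFT (𝒜.GBOM rank₂).GFT := by
    linarith [le_max_left (𝒜.GSOM rank₁).GFT (𝒜.GBOM rank₂).GFT,
      le_max_right (𝒜.GSOM rank₁).GFT (𝒜.GBOM rank₂).GFT]
  refine ⟨hS, hB, hlub, hadd, hmax, ?_⟩
  rcases le_max_iff.1 hmax with h | h
  · exact ⟨_, hS.1, hS.2.1, hS.2.2, h⟩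
  · exact ⟨_, hB.1, hB.2.1, hB.2.2, h⟩
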